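/- Let $(M,g)$ be a compact smooth two-dimensional Riemannian manifold without boundary, and let $f:M\to\mathbb{R}$ be a Morse function, i.e. a smooth function whose Hessian is nondegenerate at every critical point. A gradient flow line is a curve $\gamma:\mathbb{R}\to M$ with $\gamma'(t)=-\nabla f(\gamma(t))$ for all $t$; let $\varphi(t,y)$ denote the point at time $t$ of the gradient flow line that is at $y$ at time $0$. For a critical point $p$ of $f$ put $$W^s(p)=\{y\in M:\lim_{t\to\infty}\varphi(t,y)=p\},\qquad W^u(p)=\{y\in M:\lim_{t\to-\infty}\varphi(t,y)=p\}.$$ The function $f$ is called Morse–Smale if it is Morse and, for all critical points $p,q$ of $f$, the submanifolds $W^s(q)$ and $W^u(p)$ intersect transversally, i.e. $T_xM=T_xW^s(q)+T_xW^u(p)$ for every $x\in W^s(q)\cap W^u(p)$. A saddle point is a critical point that is not a local extremum, and a Neumann line is a nonconstant gradient flow line contained in $W^s(r)$ or in $W^u(r)$ for some saddle point $r$. Then $f$ is Morse–Smale if and only if there is no Neumann line connecting two saddle points, i.e. no Neumann line $\gamma$ and distinct saddle points $q,p$ with $\lim_{t\to-\infty}\gamma(t)=q$ and $\lim_{t\to\infty}\gamma(t)=p$.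 -/

import Mathlib

open Set Filter Topology
open scoped Manifold ContDiff

noncomputable section

namespace GradientFlow

variable {n : ℕ} {M : Type*} [TopologicalSpace M] [ChartedSpace (EuclideanSpace ℝ (Fin n)) M]

/-- A smooth Riemannian metric on a smooth `n`-dimensional manifold without boundary. -/
abbrev Metric (n : ℕ) (M : Type*) [TopologicalSpace M]
    [ChartedSpace (EuclideanSpace ℝ (Fin n)) M] [IsManifold (𝓡 n) ∞ M] :=
  Bundle.ContMDiffRiemannianMetric (𝓡 n) ∞ (EuclideanSpace ℝ (Fin n))
    (fun x : M => TangentSpace (𝓡 n) x)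

/-- The scalar product on the tangent space at `x`, as a bilinear form. -/
def Metric.form [IsManifold (𝓡 n) ∞ M] (g : Metric n M) (x : M) :
    LinearMap.BilinForm ℝ (TangentSpace (𝓡 n) x) :=
  LinearMap.mk₂ ℝ (fun v w => g.inner x v w)
    (by intros; simp) (by intros; simp) (by intros; simp) (by intros; simp)

theorem Metric.form_nondegenerate [IsManifold (𝓡 n) ∞ M] (g : Metric n M) (x : M) :
    (g.form x).Nondegenerate := by
  constructor
  · intro v hv
    by_contra h
    exact (g.pos x v h).ne' (hv v)
  · intro v hv
    by_contra h
    exact (g.pos x v h).ne' (hv v)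

instance (x : M) : FiniteDimensional ℝ (TangentSpace (𝓡 n) x) :=
  inferInstanceAs (FiniteDimensional ℝ (EuclideanSpace ℝ (Fin n)))

/-- The differential of a real function at `x`, as a linear form on the tangent space. -/
def differential (f : M → ℝ) (x : M) : Module.Dual ℝ (TangentSpace (𝓡 n) x) :=
  (mfderiv (𝓡 n) 𝓘(ℝ, ℝ) f x).toLinearMap

/-- The Riemannian gradient: the vector `∇f(x)` with `g(∇f(x), w) = df(x) w` for all `w`. -/
def grad [IsManifold (𝓡 n) ∞ M] (g : Metric n M) (f : M → ℝ) (x : M) : TangentSpace (𝓡 n) x :=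
  ((g.form x).toDual (g.form_nondegenerate x)).symm (differential f x)

/-- `x` is a critical point of `f`. -/
def IsCriticalPoint (f : M → ℝ) (x : M) : Prop :=
  mfderiv (𝓡 n) 𝓘(ℝ, ℝ) f x = 0

/-- The Hessian matrix of `f` at `p` in the preferred chart around `p`. At a critical point its
nondegeneracy does not depend on the chart (nor on a metric). -/
def hessian (f : M → ℝ) (p : M) : Matrix (Fin n) (Fin n) ℝ :=
  Matrix.of fun i j =>
    fderiv ℝ (fderiv ℝ (f ∘ (extChartAt (𝓡 n) p).symm)) (extChartAt (𝓡 n) p p)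
      (EuclideanSpace.single i 1) (EuclideanSpace.single j 1)

variable (n) in
/-- A Morse function: smooth, with nondegenerate Hessian at every critical point. -/
structure IsMorse (f : M → ℝ) : Prop where
  smooth : ContMDiff (𝓡 n) 𝓘(ℝ, ℝ) ∞ f
  nondegenerate : ∀ p : M, IsCriticalPoint (n := n) f p → (hessian (n := n) f p).det ≠ 0

variable (n) in
/-- A saddle point: a critical point that is neither a local minimum nor a local maximum. -/
def IsSaddle (f : M → ℝ) (p : M) : Prop :=
  IsCriticalPoint (n := n) f p ∧ ¬ IsLocalExtr f p

/-- A (complete, parametrized) gradient flow line: a solution `γ : ℝ → M` of `γ' = -∇f(γ)`. -/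
def IsFlowLine [IsManifold (𝓡 n) ∞ M] (g : Metric n M) (f : M → ℝ) (γ : ℝ → M) : Prop :=
  IsMIntegralCurve (I := 𝓡 n) γ (fun x => -grad g f x)

/-- The stable manifold of `p`: the points whose flow line tends to `p` as `t → ∞`. -/
def stable [IsManifold (𝓡 n) ∞ M] (g : Metric n M) (f : M → ℝ) (p : M) : Set M :=
  {y | ∃ γ : ℝ → M, IsFlowLine g f γ ∧ γ 0 = y ∧ Tendsto γ atTop (𝓝 p)}

/-- The unstable manifold of `p`: the points whose flow line tends to `p` as `t → -∞`. -/
def unstable [IsManifold (𝓡 n) ∞ M] (g : Metric n M) (f : M → ℝ) (p : M) : Set M :=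
  {y | ∃ γ : ℝ → M, IsFlowLine g f γ ∧ γ 0 = y ∧ Tendsto γ atBot (𝓝 p)}

/-- The tangent space at `x` of a submanifold `S`, inside the tangent space of the ambient
manifold: it is spanned by the velocities at time `0` of the curves in `S` that pass through `x` at
time `0` and are differentiable there. (For an embedded submanifold `S`, locally the zero set of a
submersion, every such velocity lies in the usual tangent space of `S`, and all of the usual
tangent space is obtained.) -/
def tangentOf (S : Set M) (x : M) : Submodule ℝ (TangentSpace (𝓡 n) x) :=
  Submodule.span ℝ {v | ∃ γ : ℝ → M, γ 0 = x ∧ (∀ᶠ t in 𝓝 (0 : ℝ), γ t ∈ S) ∧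
    HasMFDerivAt 𝓘(ℝ, ℝ) (𝓡 n) γ 0 ((1 : ℝ →L[ℝ] ℝ).smulRight v)}

variable (n) in
/-- Transversality: at each common point, the two tangent spaces together span the tangent space
of the ambient manifold. -/
def Transversal (S T : Set M) : Prop :=
  ∀ x ∈ S ∩ T, tangentOf (n := n) S x ⊔ tangentOf (n := n) T x = ⊤

/-- A Morse–Smale function: a Morse function such that, for all critical points `p`, `q`, the
stable manifold of `q` and the unstable manifold of `p` are transversal. -/
def IsMorseSmale [IsManifold (𝓡 n) ∞ M] (g : Metric n M) (f : M → ℝ) : Prop :=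
  IsMorse n f ∧ ∀ p q : M, IsCriticalPoint (n := n) f p → IsCriticalPoint (n := n) f q →
    Transversal n (stable g f q) (unstable g f p)

/-- A Neumann line: a nonconstant gradient flow line contained in the stable or in the unstable
manifold of a saddle point. -/
def IsNeumannLine [IsManifold (𝓡 n) ∞ M] (g : Metric n M) (f : M → ℝ) (γ : ℝ → M) : Prop :=
  IsFlowLine g f γ ∧ ∃ r : M, IsSaddle n f r ∧
    ((∀ t, γ t ∈ stable g f r \ {r}) ∨ (∀ t, γ t ∈ unstable g f r \ {r}))

/-- The line `γ` connects `q` to `p`: it begins at `q` and ends at `p`. -/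
def Connects (γ : ℝ → M) (q p : M) : Prop :=
  Tendsto γ atBot (𝓝 q) ∧ Tendsto γ atTop (𝓝 p)

end GradientFlow

end

/-! Let `x` lie in the stable manifold of `q` and the unstable manifold of `p`. If `q` is a local
minimum, its stable manifold is open and its tangent space at `x` is everything; the same holds for
the unstable manifold of a local maximum `p`. If `x` is regular, `f` strictly decreases along its
orbit, so `q` is not a maximum and `p` is not a minimum. If `x` is critical, then `x = p = q`, and
at a saddle the contracting and expanding directions are tangent to the two manifolds and span the
plane. Thus transversality can fail only at a regular `x` with `p` and `q` both saddles. They are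
then distinct, since `f q < f x < f p`, and the orbit of `x` is a Neumann line connecting them.
Conversely, at a point of a connecting line both tangent spaces lie in the line spanned by the
gradient, so they cannot span a plane.

Two facts about a saddle carry this, both obtained without constructing the stable manifold as a
submanifold. The upper bound `IsGradFlow.tangentOf_stable_le`: near a regular point the stable set
is a single orbit. Indeed, two orbits staying near the saddle with the same contracting coordinate
coincide, because the difference of squares of the expanding and contracting coordinates of their
separation would otherwise grow without bound (`SaddleFrame.IsCloseOn.eq_of_forall_mem`). The lower
bound `IsGradFlow.es_mem_tangentOf_stable`: a segment across a thin cone about the contracting axis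
is connected, and the points escaping on the two sides form disjoint nonempty open subsets, so some
point never escapes and tends to the saddle (`IsGradFlow.exists_mem_stable_cone`). Unstable
manifolds are handled by replacing `f` with `-f`. -/

noncomputable section

namespace GradientFlow

/-! ### Velocities of curves and vector fields read in charts. -/

section ChartCalculus

variable {n : ℕ} {M : Type*} [TopologicalSpace M] [ChartedSpace (EuclideanSpace ℝ (Fin n)) M]

theorem hasMFDerivAt_curve_iff {γ : ℝ → M} {t : ℝ} {v : EuclideanSpace ℝ (Fin n)} :
    HasMFDerivAt 𝓘(ℝ, ℝ) (𝓡 n) γ t ((1 : ℝ →L[ℝ] ℝ).smulRight v) ↔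
      ContinuousAt γ t ∧ HasDerivAt (extChartAt (𝓡 n) (γ t) ∘ γ) v t := by
  constructor
  · intro h
    refine ⟨h.1, ?_⟩
    have h2 := h.2
    rw [ModelWithCorners.range_eq_univ] at h2
    have h3 : HasFDerivAt (extChartAt (𝓡 n) (γ t) ∘ γ) ((1 : ℝ →L[ℝ] ℝ).smulRight v) t :=
      hasFDerivWithinAt_univ.1 h2
    exact h3.hasDerivAt.congr_deriv (by simp)
  · rintro ⟨h1, h2⟩
    refine ⟨h1, ?_⟩
    rw [ModelWithCorners.range_eq_univ]
    have h3 : HasFDerivAt (extChartAt (𝓡 n) (γ t) ∘ γ) ((1 : ℝ →L[ℝ] ℝ).smulRight v) t :=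
      h2.hasFDerivAt.congr_fderiv (by ext; simp)
    exact hasFDerivWithinAt_univ.2 h3

variable [IsManifold (𝓡 n) 1 M]

theorem hasFDerivAt_coordChange {x y z : M}
    (hx : z ∈ (extChartAt (𝓡 n) x).source) (hy : z ∈ (extChartAt (𝓡 n) y).source) :
    HasFDerivAt (extChartAt (𝓡 n) y ∘ (extChartAt (𝓡 n) x).symm)
      (tangentCoordChange (𝓡 n) x y z) (extChartAt (𝓡 n) x z) := by
  have := hasFDerivWithinAt_tangentCoordChange (I := 𝓡 n) ⟨hx, hy⟩
  simpa using this

theorem hasDerivAt_chart_of_hasMFDerivAt {γ : ℝ → M} {t : ℝ} {v : EuclideanSpace ℝ (Fin n)}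
    (h : HasMFDerivAt 𝓘(ℝ, ℝ) (𝓡 n) γ t ((1 : ℝ →L[ℝ] ℝ).smulRight v)) {x : M}
    (hx : γ t ∈ (extChartAt (𝓡 n) x).source) :
    HasDerivAt (extChartAt (𝓡 n) x ∘ γ) (tangentCoordChange (𝓡 n) (γ t) x (γ t) v) t := by
  obtain ⟨hc, hd⟩ := hasMFDerivAt_curve_iff.1 h
  have h1 := (hasFDerivAt_coordChange (mem_extChartAt_source (I := 𝓡 n) (γ t)) hx)
  have h2 := h1.comp_hasDerivAt t hd
  refine h2.congr_of_eventuallyEq ?_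
  filter_upwards [hc.preimage_mem_nhds (extChartAt_source_mem_nhds (I := 𝓡 n) (γ t))] with s hs
  simp only [Function.comp_apply]
  rw [(extChartAt (𝓡 n) (γ t)).left_inv hs]

theorem hasMFDerivAt_of_hasDerivAt_chart {γ : ℝ → M} {t : ℝ} {w : EuclideanSpace ℝ (Fin n)} {x : M}
    (hc : ContinuousAt γ t) (hx : γ t ∈ (extChartAt (𝓡 n) x).source)
    (h : HasDerivAt (extChartAt (𝓡 n) x ∘ γ) w t) :
    HasMFDerivAt 𝓘(ℝ, ℝ) (𝓡 n) γ t
      ((1 : ℝ →L[ℝ] ℝ).smulRight (tangentCoordChange (𝓡 n) x (γ t) (γ t) w)) := by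
  refine hasMFDerivAt_curve_iff.2 ⟨hc, ?_⟩
  have h1 := (hasFDerivAt_coordChange hx (mem_extChartAt_source (I := 𝓡 n) (γ t)))
  have h2 := h1.comp_hasDerivAt t h
  refine h2.congr_of_eventuallyEq ?_
  filter_upwards [hc.preimage_mem_nhds (extChartAt_source_mem_nhds' hx)] with s hs
  simp only [Function.comp_apply]
  rw [(extChartAt (𝓡 n) x).left_inv hs]

theorem coordChange_coordChange {x y z : M} (hx : z ∈ (extChartAt (𝓡 n) x).source)
    (hy : z ∈ (extChartAt (𝓡 n) y).source) (v : EuclideanSpace ℝ (Fin n)) :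
    tangentCoordChange (𝓡 n) y x z (tangentCoordChange (𝓡 n) x y z v) = v := by
  rw [tangentCoordChange_comp ⟨⟨hx, hy⟩, hx⟩, tangentCoordChange_self hx]

/-- The chart representation around `x` of a vector field on `M`. -/
def chartRep (v : (y : M) → TangentSpace (𝓡 n) y) (x : M) (z : EuclideanSpace ℝ (Fin n)) :
    EuclideanSpace ℝ (Fin n) :=
  tangentCoordChange (𝓡 n) ((extChartAt (𝓡 n) x).symm z) x ((extChartAt (𝓡 n) x).symm z)
    (v ((extChartAt (𝓡 n) x).symm z))

theorem chartRep_extChartAt (v : (y : M) → TangentSpace (𝓡 n) y) {x y : M}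
    (hy : y ∈ (extChartAt (𝓡 n) x).source) :
    chartRep v x (extChartAt (𝓡 n) x y) = tangentCoordChange (𝓡 n) y x y (v y) := by
  unfold chartRep
  rw [(extChartAt (𝓡 n) x).left_inv hy]

/-- This is the bridge that lets Picard–Lindelöf in the model space be applied to a vector field on
the manifold. -/
theorem contMDiffAt_section_iff_chartRep (v : (y : M) → TangentSpace (𝓡 n) y) (x : M) :
    ContMDiffAt (𝓡 n) (𝓡 n).tangent 1 (fun y => (⟨y, v y⟩ : TangentBundle (𝓡 n) M)) x ↔
      ContDiffAt ℝ 1 (chartRep v x) (extChartAt (𝓡 n) x x) := by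
  have e1 := Bundle.contMDiffAt_section (IB := 𝓡 n) (F := EuclideanSpace ℝ (Fin n))
    (E := fun y : M => TangentSpace (𝓡 n) y) (n := 1) (s := v) x
  refine e1.trans ?_
  rw [contMDiffAt_iff_source_of_mem_source (x' := x) (mem_chart_source _ x)]
  simp only [mfld_simps, contMDiffWithinAt_univ]
  rw [contMDiffAt_iff_contDiffAt]
  rfl

end ChartCalculus

/-- In finite dimension an operator is given by its values on a basis, so smoothness can be tested
vector by vector. -/
theorem contDiffAt_clm_of_apply {D E F : Type*} [NormedAddCommGroup D] [NormedSpace ℝ D]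
    [NormedAddCommGroup E] [NormedSpace ℝ E] [NormedAddCommGroup F] [NormedSpace ℝ F]
    [FiniteDimensional ℝ E] {k : ℕ∞ω} {f : D → E →L[ℝ] F} {x : D}
    (h : ∀ y, ContDiffAt ℝ k (fun x => f x y) x) : ContDiffAt ℝ k f x := by
  have hd : Module.finrank ℝ E = Module.finrank ℝ (Fin (Module.finrank ℝ E) → ℝ) :=
    (Module.finrank_fin_fun ℝ).symm
  let e₁ := ContinuousLinearEquiv.ofFinrankEq hd
  let e₂ := (e₁.arrowCongr (1 : F ≃L[ℝ] F)).trans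
    (ContinuousLinearEquiv.piRing (Fin (Module.finrank ℝ E)))
  rw [← Function.id_comp f, ← e₂.symm_comp_self]
  exact e₂.symm.contDiff.contDiffAt.comp x (contDiffAt_pi.mpr fun i => h _)

/-! ### The metric and the gradient in charts. -/

section ChartMetric

variable {n : ℕ} {M : Type*} [TopologicalSpace M] [ChartedSpace (EuclideanSpace ℝ (Fin n)) M]
  [IsManifold (𝓡 n) ∞ M]

/-- The matrix of the metric in the chart around `x`, as a bilinear form on the model space. -/
def chartMetric (g : Metric n M) (x : M) (z : EuclideanSpace ℝ (Fin n)) :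
    EuclideanSpace ℝ (Fin n) →L[ℝ] EuclideanSpace ℝ (Fin n) →L[ℝ] ℝ :=
  ContinuousLinearMap.bilinearComp
    (g.inner ((extChartAt (𝓡 n) x).symm z) :
      EuclideanSpace ℝ (Fin n) →L[ℝ] EuclideanSpace ℝ (Fin n) →L[ℝ] ℝ)
    (tangentCoordChange (𝓡 n) x ((extChartAt (𝓡 n) x).symm z) ((extChartAt (𝓡 n) x).symm z))
    (tangentCoordChange (𝓡 n) x ((extChartAt (𝓡 n) x).symm z) ((extChartAt (𝓡 n) x).symm z))

theorem chartMetric_apply (g : Metric n M) (x : M) (z a b : EuclideanSpace ℝ (Fin n)) :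
    chartMetric g x z a b = g.inner ((extChartAt (𝓡 n) x).symm z)
      (tangentCoordChange (𝓡 n) x ((extChartAt (𝓡 n) x).symm z) ((extChartAt (𝓡 n) x).symm z) a)
      (tangentCoordChange (𝓡 n) x ((extChartAt (𝓡 n) x).symm z)
        ((extChartAt (𝓡 n) x).symm z) b) := rfl

theorem inner_grad (g : Metric n M) (f : M → ℝ) (x : M) (w : TangentSpace (𝓡 n) x) :
    g.inner x (grad g f x) w = mfderiv (𝓡 n) 𝓘(ℝ, ℝ) f x w := by
  have := LinearMap.BilinForm.apply_toDual_symm_apply (B := g.form x)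
    (hB := g.form_nondegenerate x) (differential f x) w
  exact this

theorem grad_eq_zero_iff (g : Metric n M) (f : M → ℝ) (x : M) :
    grad g f x = 0 ↔ IsCriticalPoint (n := n) f x := by
  constructor
  · intro h
    unfold IsCriticalPoint
    refine ContinuousLinearMap.ext fun w => ?_
    have h1 := inner_grad g f x w
    rw [h] at h1
    have h2 : g.inner x 0 w = 0 := by rw [map_zero]; rfl
    exact h1.symm.trans h2
  · intro h
    by_contra hne
    have h1 := inner_grad g f x (grad g f x)
    have h2 := g.pos x _ hne
    rw [h1, h] at h2
    exact lt_irrefl 0 h2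

theorem grad_neg (g : Metric n M) (f : M → ℝ) (x : M) :
    grad g (fun y => -f y) x = -grad g f x := by
  unfold grad differential
  have : mfderiv (𝓡 n) 𝓘(ℝ, ℝ) (fun y => -f y) x = -mfderiv (𝓡 n) 𝓘(ℝ, ℝ) f x :=
    mfderiv_neg
  rw [this]
  exact map_neg (g.form x |>.toDual (g.form_nondegenerate x)).symm (differential f x)

theorem coordChange_injective {x : M} {z : EuclideanSpace ℝ (Fin n)}
    (hz : z ∈ (extChartAt (𝓡 n) x).target) {a : EuclideanSpace ℝ (Fin n)}
    (ha : tangentCoordChange (𝓡 n) x ((extChartAt (𝓡 n) x).symm z)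
      ((extChartAt (𝓡 n) x).symm z) a = 0) : a = 0 := by
  have h := coordChange_coordChange ((extChartAt (𝓡 n) x).map_target hz)
    (mem_extChartAt_source (I := 𝓡 n) ((extChartAt (𝓡 n) x).symm z)) a
  rw [ha] at h
  simpa using h.symm

theorem chartMetric_pos (g : Metric n M) {x : M} {z : EuclideanSpace ℝ (Fin n)}
    (hz : z ∈ (extChartAt (𝓡 n) x).target) {a : EuclideanSpace ℝ (Fin n)} (ha : a ≠ 0) :
    0 < chartMetric g x z a a := by
  rw [chartMetric_apply]
  exact g.pos _ _ fun h => ha (coordChange_injective hz h)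

theorem chartMetric_symm (g : Metric n M) (x : M) (z a b : EuclideanSpace ℝ (Fin n)) :
    chartMetric g x z a b = chartMetric g x z b a := by
  rw [chartMetric_apply, chartMetric_apply]
  exact g.symm _ _ _

theorem mfderiv_coordChange {f : M → ℝ} {x : M} {z : EuclideanSpace ℝ (Fin n)}
    (hz : z ∈ (extChartAt (𝓡 n) x).target)
    (hf : MDifferentiableAt (𝓡 n) 𝓘(ℝ, ℝ) f ((extChartAt (𝓡 n) x).symm z))
    (b : EuclideanSpace ℝ (Fin n)) :
    mfderiv (𝓡 n) 𝓘(ℝ, ℝ) f ((extChartAt (𝓡 n) x).symm z)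
      (tangentCoordChange (𝓡 n) x ((extChartAt (𝓡 n) x).symm z) ((extChartAt (𝓡 n) x).symm z) b) =
      fderiv ℝ (f ∘ (extChartAt (𝓡 n) x).symm) z b := by
  set y := (extChartAt (𝓡 n) x).symm z with hy
  have hys : y ∈ (extChartAt (𝓡 n) x).source := (extChartAt (𝓡 n) x).map_target hz
  have hzy : extChartAt (𝓡 n) x y = z := (extChartAt (𝓡 n) x).right_inv hz
  have h1 := hf.hasMFDerivAt.2
  rw [ModelWithCorners.range_eq_univ] at h1
  have h2 : HasFDerivAt (f ∘ (extChartAt (𝓡 n) y).symm) (mfderiv (𝓡 n) 𝓘(ℝ, ℝ) f y)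
    (extChartAt (𝓡 n) y y) := hasFDerivWithinAt_univ.1 h1
  have h3 := hasFDerivAt_coordChange hys (mem_extChartAt_source (I := 𝓡 n) y)
  rw [hzy] at h3
  let L : EuclideanSpace ℝ (Fin n) →L[ℝ] ℝ := mfderiv (𝓡 n) 𝓘(ℝ, ℝ) f y
  have h4 : HasFDerivAt (f ∘ (extChartAt (𝓡 n) y).symm) L
    ((extChartAt (𝓡 n) y ∘ (extChartAt (𝓡 n) x).symm) z) := h2
  have h5 := h4.comp z h3
  have h6 : HasFDerivAt (f ∘ (extChartAt (𝓡 n) x).symm) (L.comp (tangentCoordChange (𝓡 n) x y y)) z := by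
    refine h5.congr_of_eventuallyEq ?_
    have : ContinuousAt (extChartAt (𝓡 n) x).symm z := continuousAt_extChartAt_symm'' hz
    filter_upwards [this.preimage_mem_nhds (extChartAt_source_mem_nhds (I := 𝓡 n) y)] with w hw
    simp only [Function.comp_apply]
    rw [(extChartAt (𝓡 n) y).left_inv hw]
  rw [h6.fderiv]
  rfl

/-- The negative gradient field in the chart around `x`. -/
def chartField (g : Metric n M) (f : M → ℝ) (x : M) :
    EuclideanSpace ℝ (Fin n) → EuclideanSpace ℝ (Fin n) :=
  chartRep (fun y => -grad g f y) x

/-- With `G` the metric matrix, `X` the field and `F` the function in the chart, this is `G X =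
-dF`. Smoothness of `X` and its linearization are both read off from this equation. -/
theorem chartMetric_chartField (g : Metric n M) {f : M → ℝ} {x : M} {z : EuclideanSpace ℝ (Fin n)}
    (hz : z ∈ (extChartAt (𝓡 n) x).target)
    (hf : MDifferentiableAt (𝓡 n) 𝓘(ℝ, ℝ) f ((extChartAt (𝓡 n) x).symm z)) :
    chartMetric g x z (chartField g f x z) = -fderiv ℝ (f ∘ (extChartAt (𝓡 n) x).symm) z := by
  ext b
  have h1 := mfderiv_coordChange hz hf b
  have h2 := inner_grad g f ((extChartAt (𝓡 n) x).symm z)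
    (tangentCoordChange (𝓡 n) x ((extChartAt (𝓡 n) x).symm z) ((extChartAt (𝓡 n) x).symm z) b)
  have := coordChange_coordChange (mem_extChartAt_source (I := 𝓡 n) ((extChartAt (𝓡 n) x).symm z))
    ((extChartAt (𝓡 n) x).map_target hz) (-grad g f ((extChartAt (𝓡 n) x).symm z))
  refine (congrArg (fun v : TangentSpace (𝓡 n) ((extChartAt (𝓡 n) x).symm z) =>
    g.inner ((extChartAt (𝓡 n) x).symm z) v (tangentCoordChange (𝓡 n) x
      ((extChartAt (𝓡 n) x).symm z) ((extChartAt (𝓡 n) x).symm z) b)) this).trans ?_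
  refine Eq.trans ?_ (congrArg Neg.neg (h2.trans h1))
  exact DFunLike.congr_fun (map_neg (g.inner ((extChartAt (𝓡 n) x).symm z)) _) _

theorem chartField_eq_zero_iff (g : Metric n M) {f : M → ℝ} {x : M} {z : EuclideanSpace ℝ (Fin n)}
    (hz : z ∈ (extChartAt (𝓡 n) x).target) :
    chartField g f x z = 0 ↔ IsCriticalPoint (n := n) f ((extChartAt (𝓡 n) x).symm z) := by
  have := coordChange_coordChange (mem_extChartAt_source (I := 𝓡 n) ((extChartAt (𝓡 n) x).symm z))
    ((extChartAt (𝓡 n) x).map_target hz) (-grad g f ((extChartAt (𝓡 n) x).symm z))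
  rw [← grad_eq_zero_iff g]
  constructor
  · intro h
    have h1 : -grad g f ((extChartAt (𝓡 n) x).symm z) = 0 :=
      this.symm.trans ((congrArg _ h).trans (map_zero _))
    exact neg_eq_zero.1 h1
  · intro h
    have h1 : -grad g f ((extChartAt (𝓡 n) x).symm z) = 0 := neg_eq_zero.2 h
    exact (congrArg (tangentCoordChange (𝓡 n) ((extChartAt (𝓡 n) x).symm z) x
      ((extChartAt (𝓡 n) x).symm z)) h1).trans (map_zero _)

theorem contDiffAt_chartMetric (g : Metric n M) (x : M) :
    ContDiffAt ℝ ∞ (chartMetric g x) (extChartAt (𝓡 n) x x) := by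
  -- A field with constant components in the chart around `x` is a smooth section; the metric is
  -- then tested on pairs of such fields.
  have hsec : ∀ a : EuclideanSpace ℝ (Fin n), ContMDiffAt (𝓡 n) (𝓡 n).tangent ∞
      (fun y => (⟨y, tangentCoordChange (𝓡 n) x y y a⟩ : TangentBundle (𝓡 n) M)) x := by
    intro a
    refine (Bundle.contMDiffAt_section (IB := 𝓡 n) (F := EuclideanSpace ℝ (Fin n))
      (E := fun y : M => TangentSpace (𝓡 n) y) (n := ∞)
      (s := fun y => tangentCoordChange (𝓡 n) x y y a) x).2 ?_
    refine (contMDiffAt_const (c := a)).congr_of_eventuallyEq ?_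
    filter_upwards [extChartAt_source_mem_nhds (I := 𝓡 n) x] with y hy
    exact coordChange_coordChange hy (mem_extChartAt_source (I := 𝓡 n) y) a
  have happ : ∀ a b : EuclideanSpace ℝ (Fin n), ContDiffAt ℝ ∞
      (fun z => chartMetric g x z a b) (extChartAt (𝓡 n) x x) := by
    intro a b
    have h1 : ContMDiffAt (𝓡 n) 𝓘(ℝ, ℝ) ∞ (fun y => g.inner y (tangentCoordChange (𝓡 n) x y y a)
        (tangentCoordChange (𝓡 n) x y y b)) x := by
      have : ContMDiffAt (𝓡 n) ((𝓡 n).prod 𝓘(ℝ, ℝ)) ∞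
          (fun y => Bundle.TotalSpace.mk' ℝ (E := Bundle.Trivial M ℝ) y
            (g.inner y (tangentCoordChange (𝓡 n) x y y a)
              (tangentCoordChange (𝓡 n) x y y b))) x := by
        apply ContMDiffAt.clm_bundle_apply₂ (F₁ := EuclideanSpace ℝ (Fin n))
          (F₂ := EuclideanSpace ℝ (Fin n)) (E₁ := fun y : M => TangentSpace (𝓡 n) y)
          (E₂ := fun y : M => TangentSpace (𝓡 n) y)
        · exact g.contMDiff.contMDiffAt
        · exact hsec a
        · exact hsec b
      simp only [Bundle.contMDiffAt_totalSpace] at this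
      exact this.2
    rw [contMDiffAt_iff_source_of_mem_source (x' := x) (mem_chart_source _ x)] at h1
    simp only [mfld_simps, contMDiffWithinAt_univ] at h1
    rw [contMDiffAt_iff_contDiffAt] at h1
    exact h1
  exact contDiffAt_clm_of_apply fun a => contDiffAt_clm_of_apply fun b => happ a b

end ChartMetric

/-! ### Smoothness and linearization of the gradient field; isolated critical points. -/

section ChartFieldSmooth

variable {n : ℕ} {M : Type*} [TopologicalSpace M] [ChartedSpace (EuclideanSpace ℝ (Fin n)) M]

theorem hessian_injective {f : M → ℝ} {x : M} (hd : (hessian (n := n) f x).det ≠ 0)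
    {a : EuclideanSpace ℝ (Fin n)}
    (ha : fderiv ℝ (fderiv ℝ (f ∘ (extChartAt (𝓡 n) x).symm)) (extChartAt (𝓡 n) x x) a = 0) :
    a = 0 := by
  by_contra hne
  apply hd
  rw [← Matrix.exists_vecMul_eq_zero_iff]
  refine ⟨WithLp.ofLp a, fun h => hne (by ext i; exact congrFun h i), ?_⟩
  ext j
  have h2 := DFunLike.congr_fun ha (EuclideanSpace.single j 1)
  have h3 : a = ∑ i, a i • EuclideanSpace.single i (1 : ℝ) := by
    ext k
    simp [Finset.sum_apply, Pi.single_apply]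
  rw [h3] at h2
  simpa [Matrix.vecMul, dotProduct, hessian] using h2

variable [IsManifold (𝓡 n) ∞ M]

theorem isInvertible_of_pos {E : Type*} [NormedAddCommGroup E] [NormedSpace ℝ E]
    [FiniteDimensional ℝ E] {B : E →L[ℝ] E →L[ℝ] ℝ} (hB : ∀ a, a ≠ 0 → 0 < B a a) :
    B.IsInvertible := by
  have hinj : Function.Injective B := by
    rw [injective_iff_map_eq_zero]
    intro a ha
    by_contra h
    have := hB a h
    rw [ha] at this
    exact lt_irrefl _ this
  have hfr : Module.finrank ℝ E = Module.finrank ℝ (E →L[ℝ] ℝ) := by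
    rw [← (LinearMap.toContinuousLinearMap (𝕜 := ℝ) (E := E) (F' := ℝ)).finrank_eq]
    exact Subspace.dual_finrank_eq.symm
  let e : E ≃ₗ[ℝ] (E →L[ℝ] ℝ) := LinearMap.linearEquivOfInjective B.toLinearMap hinj hfr
  exact ⟨e.toContinuousLinearEquiv, by ext a b; rfl⟩

theorem contDiffAt_comp_chart_symm {f : M → ℝ} (hf : ContMDiff (𝓡 n) 𝓘(ℝ, ℝ) ∞ f) (x : M) :
    ContDiffAt ℝ ∞ (f ∘ (extChartAt (𝓡 n) x).symm) (extChartAt (𝓡 n) x x) := by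
  have h1 := hf.contMDiffAt (x := x)
  rw [contMDiffAt_iff_source_of_mem_source (x' := x) (mem_chart_source _ x)] at h1
  simp only [mfld_simps, contMDiffWithinAt_univ] at h1
  rw [contMDiffAt_iff_contDiffAt] at h1
  exact h1

/-- The field is `-G⁻¹ dF`, and inversion is smooth at the positive definite `G`. -/
theorem contDiffAt_chartField (g : Metric n M) {f : M → ℝ} (hf : ContMDiff (𝓡 n) 𝓘(ℝ, ℝ) ∞ f)
    (x : M) : ContDiffAt ℝ ∞ (chartField g f x) (extChartAt (𝓡 n) x x) := by
  have hinv : (chartMetric g x (extChartAt (𝓡 n) x x)).IsInvertible :=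
    isInvertible_of_pos fun a ha => chartMetric_pos g (mem_extChartAt_target x) ha
  have h1 : ContDiffAt ℝ ∞ (fun z => ContinuousLinearMap.inverse (chartMetric g x z)
      (-fderiv ℝ (f ∘ (extChartAt (𝓡 n) x).symm) z)) (extChartAt (𝓡 n) x x) := by
    refine ContDiffAt.clm_apply ?_ ?_
    · exact hinv.contDiffAt_map_inverse.comp _ (contDiffAt_chartMetric g x)
    · exact ((contDiffAt_comp_chart_symm hf x).fderiv_right (m := ∞) (by simp)).neg
  refine h1.congr_of_eventuallyEq ?_
  filter_upwards [extChartAt_target_mem_nhds (I := 𝓡 n) x] with z hz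
  have hi : (chartMetric g x z).IsInvertible :=
    isInvertible_of_pos fun a ha => chartMetric_pos g hz ha
  rw [← chartMetric_chartField g hz (hf.mdifferentiableAt (by simp))]
  obtain ⟨e, he⟩ := hi
  rw [← he]
  simp

theorem contMDiff_neg_grad (g : Metric n M) {f : M → ℝ} (hf : ContMDiff (𝓡 n) 𝓘(ℝ, ℝ) ∞ f) :
    ContMDiff (𝓡 n) (𝓡 n).tangent 1
      (fun y => (⟨y, -grad g f y⟩ : TangentBundle (𝓡 n) M)) := fun x =>
  (contMDiffAt_section_iff_chartRep (fun y => -grad g f y) x).2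
    ((contDiffAt_chartField g hf x).of_le (by simp))

/-- The linearization of the negative gradient field at `x`, in the chart around `x`. -/
def linearization (g : Metric n M) (f : M → ℝ) (x : M) :
    EuclideanSpace ℝ (Fin n) →L[ℝ] EuclideanSpace ℝ (Fin n) :=
  fderiv ℝ (chartField g f x) (extChartAt (𝓡 n) x x)

theorem hasStrictFDerivAt_chartField (g : Metric n M) {f : M → ℝ}
    (hf : ContMDiff (𝓡 n) 𝓘(ℝ, ℝ) ∞ f) (x : M) :
    HasStrictFDerivAt (chartField g f x) (linearization g f x) (extChartAt (𝓡 n) x x) :=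
  (contDiffAt_chartField g hf x).hasStrictFDerivAt (by simp)

theorem chartField_self (g : Metric n M) {f : M → ℝ} {x : M}
    (hx : IsCriticalPoint (n := n) f x) :
    chartField g f x (extChartAt (𝓡 n) x x) = 0 := by
  rw [chartField_eq_zero_iff g (mem_extChartAt_target x), (extChartAt (𝓡 n) x).left_inv
    (mem_extChartAt_source x)]
  exact hx

/-- Differentiate `G X = -dF` at a zero of `X`: the term with the derivative of `G` vanishes,
leaving `G A = -Hess`. -/
theorem chartMetric_linearization (g : Metric n M) {f : M → ℝ}
    (hf : ContMDiff (𝓡 n) 𝓘(ℝ, ℝ) ∞ f) {x : M} (hx : IsCriticalPoint (n := n) f x)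
    (a : EuclideanSpace ℝ (Fin n)) :
    chartMetric g x (extChartAt (𝓡 n) x x) (linearization g f x a) =
      -fderiv ℝ (fderiv ℝ (f ∘ (extChartAt (𝓡 n) x).symm)) (extChartAt (𝓡 n) x x) a := by
  have h1 := (contDiffAt_chartMetric g x).differentiableAt (by simp) |>.hasFDerivAt
  have h2 := (hasStrictFDerivAt_chartField g hf x).hasFDerivAt
  have h3 := h1.clm_apply h2
  have h4 : HasFDerivAt (fun z => -fderiv ℝ (f ∘ (extChartAt (𝓡 n) x).symm) z)
      (-fderiv ℝ (fderiv ℝ (f ∘ (extChartAt (𝓡 n) x).symm)) (extChartAt (𝓡 n) x x))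
      (extChartAt (𝓡 n) x x) :=
    (((contDiffAt_comp_chart_symm hf x).fderiv_right (m := ∞) (by simp)).differentiableAt
      (by simp)).hasFDerivAt.neg
  have h5 := h4.congr_of_eventuallyEq (f₁ := fun z => chartMetric g x z (chartField g f x z)) (by
    filter_upwards [extChartAt_target_mem_nhds (I := 𝓡 n) x] with z hz
    exact chartMetric_chartField g hz (hf.mdifferentiableAt (by simp)))
  have h6 := DFunLike.congr_fun (h3.unique h5) a
  simp only [ContinuousLinearMap.comp_apply, chartField_self g hx, map_zero, add_zero] at h6
  exact h6

theorem hessian_symm {f : M → ℝ} (hf : ContMDiff (𝓡 n) 𝓘(ℝ, ℝ) ∞ f) (x : M)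
    (a b : EuclideanSpace ℝ (Fin n)) :
    fderiv ℝ (fderiv ℝ (f ∘ (extChartAt (𝓡 n) x).symm)) (extChartAt (𝓡 n) x x) a b =
      fderiv ℝ (fderiv ℝ (f ∘ (extChartAt (𝓡 n) x).symm)) (extChartAt (𝓡 n) x x) b a :=
  (contDiffAt_comp_chart_symm hf x).isSymmSndFDerivAt
    (by rw [minSmoothness_of_isRCLikeNormedField]; exact ENat.LEInfty.out) a b

/-- The differential of `f` in the chart has an injective derivative, the Hessian, so its zero is
isolated. -/
theorem eventually_not_isCriticalPoint {f : M → ℝ} (hf : IsMorse n f) {x : M}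
    (hx : IsCriticalPoint (n := n) f x) :
    ∀ᶠ y in 𝓝[≠] x, ¬ IsCriticalPoint (n := n) f y := by
  set z₀ := extChartAt (𝓡 n) x x with hz₀
  have h1 : HasFDerivAt (fderiv ℝ (f ∘ (extChartAt (𝓡 n) x).symm))
      (fderiv ℝ (fderiv ℝ (f ∘ (extChartAt (𝓡 n) x).symm)) z₀) z₀ :=
    (((contDiffAt_comp_chart_symm hf.smooth x).fderiv_right (m := ∞) (by simp)).differentiableAt
      (by simp)).hasFDerivAt
  have h2 : ∃ C, AntilipschitzWith C
      (fderiv ℝ (fderiv ℝ (f ∘ (extChartAt (𝓡 n) x).symm)) z₀) := by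
    obtain ⟨K, -, hK⟩ := LinearMap.exists_antilipschitzWith
      (fderiv ℝ (fderiv ℝ (f ∘ (extChartAt (𝓡 n) x).symm)) z₀).toLinearMap
      (LinearMap.ker_eq_bot'.2 fun a ha => hessian_injective (hf.nondegenerate x hx) ha)
    exact ⟨K, hK⟩
  have h3 := h1.eventually_ne (c := 0) h2
  rw [eventually_nhdsWithin_iff] at h3 ⊢
  filter_upwards [(continuousAt_extChartAt (I := 𝓡 n) x).eventually h3,
    extChartAt_source_mem_nhds (I := 𝓡 n) x] with y hy hys hne hcrit
  refine hy (fun h => hne ((extChartAt (𝓡 n) x).injOn hys (mem_extChartAt_source x) h)) ?_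
  ext b
  have hfd : MDifferentiableAt (𝓡 n) 𝓘(ℝ, ℝ) f
    ((extChartAt (𝓡 n) x).symm (extChartAt (𝓡 n) x y)) :=
    hf.smooth.mdifferentiableAt (by simp)
  have h4 := mfderiv_coordChange ((extChartAt (𝓡 n) x).map_source hys) hfd b
  have h5 : IsCriticalPoint (n := n) f ((extChartAt (𝓡 n) x).symm (extChartAt (𝓡 n) x y)) := by
    rw [(extChartAt (𝓡 n) x).left_inv hys]
    exact hcrit
  unfold IsCriticalPoint at h5
  rw [h5] at h4
  exact h4.symm

end ChartFieldSmooth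

/-! ### Existence of a continuous global flow on a compact manifold. -/

section Flow

variable {n : ℕ} {M : Type*} [TopologicalSpace M] [ChartedSpace (EuclideanSpace ℝ (Fin n)) M]
  [IsManifold (𝓡 n) 1 M] {v : (y : M) → TangentSpace (𝓡 n) y}

/-- Picard–Lindelöf in the chart around `x`; the times and starting points are shrunk until
solutions stay in the chart's target and can be carried back to the manifold. -/
theorem exists_local_flow
    (hv : ContMDiff (𝓡 n) (𝓡 n).tangent 1 (fun y => (⟨y, v y⟩ : TangentBundle (𝓡 n) M))) (x : M) :
    ∃ ε > (0 : ℝ), ∃ U ∈ 𝓝 x, ∃ α : M × ℝ → M,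
      (∀ y ∈ U, α (y, 0) = y ∧ IsMIntegralCurveOn (fun t => α (y, t)) v (Ioo (-ε) ε)) ∧
      ContinuousOn α (U ×ˢ Ioo (-ε) ε) := by
  set z₀ := extChartAt (𝓡 n) x x with hz₀
  have hX := (contMDiffAt_section_iff_chartRep v x).1 (hv x)
  obtain ⟨ε, hε, a, r, L, K, hr, hpl⟩ := IsPicardLindelof.of_contDiffAt_one hX
  obtain ⟨β, hβ, hβc⟩ :=
    (hpl 0).exists_forall_mem_closedBall_eq_hasDerivWithinAt_continuousOn
  simp only [zero_sub, zero_add] at hβ hβc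
  have hr' : (0 : ℝ) < r := hr
  have hz₀0 : β (z₀, 0) = z₀ := (hβ z₀ (Metric.mem_closedBall_self hr'.le)).1
  have hcont : ContinuousAt β (z₀, 0) := hβc.continuousAt
    (prod_mem_nhds (Metric.closedBall_mem_nhds _ hr') (Icc_mem_nhds (by linarith) hε))
  have htar : ∀ᶠ q in 𝓝 (z₀, (0 : ℝ)), β q ∈ (extChartAt (𝓡 n) x).target := by
    apply hcont.eventually
    rw [hz₀0]
    exact extChartAt_target_mem_nhds x
  rw [nhds_prod_eq, eventually_prod_iff] at htar
  obtain ⟨pa, hpa, pb, hpb, hab⟩ := htar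
  obtain ⟨δ, hδ, hδb⟩ := Metric.eventually_nhds_iff_ball.1 hpb
  have hin : ∀ t ∈ Ioo (-(min δ ε)) (min δ ε), pb t ∧ t ∈ Ioo (-ε) ε := by
    intro t ht
    refine ⟨hδb t ?_, by linarith [ht.1, min_le_right δ ε], by linarith [ht.2, min_le_right δ ε]⟩
    rw [Real.ball_eq_Ioo]
    exact ⟨by linarith [ht.1, min_le_left δ ε], by linarith [ht.2, min_le_left δ ε]⟩
  have hU : ∀ᶠ y in 𝓝 x, y ∈ (extChartAt (𝓡 n) x).source ∧ pa (extChartAt (𝓡 n) x y) ∧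
      extChartAt (𝓡 n) x y ∈ Metric.closedBall z₀ r :=
    Filter.Eventually.and (extChartAt_source_mem_nhds (I := 𝓡 n) x)
      (((continuousAt_extChartAt (I := 𝓡 n) x).eventually hpa).and
        ((continuousAt_extChartAt (I := 𝓡 n) x).eventually (Metric.closedBall_mem_nhds _ hr')))
  refine ⟨min δ ε, lt_min hδ hε, _, hU,
    fun q => (extChartAt (𝓡 n) x).symm (β (extChartAt (𝓡 n) x q.1, q.2)), ?_, ?_⟩
  · rintro y ⟨hys, hya, hyr⟩
    refine ⟨?_, ?_⟩
    · simp only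
      rw [(hβ _ hyr).1, (extChartAt (𝓡 n) x).left_inv hys]
    · intro t ht
      have hd := ((hβ _ hyr).2 t (Ioo_subset_Icc_self (hin t ht).2)).hasDerivAt
        (Icc_mem_nhds (hin t ht).2.1 (hin t ht).2.2)
      have htt : β (extChartAt (𝓡 n) x y, t) ∈ (extChartAt (𝓡 n) x).target :=
        hab hya (hin t ht).1
      have hca : ContinuousAt
          (fun t => (extChartAt (𝓡 n) x).symm (β (extChartAt (𝓡 n) x y, t))) t :=
        ContinuousAt.comp (g := (extChartAt (𝓡 n) x).symm)
          (f := fun t => β (extChartAt (𝓡 n) x y, t)) (continuousAt_extChartAt_symm'' htt)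
          hd.continuousAt
      have hsrc := (extChartAt (𝓡 n) x).map_target htt
      have h1 := hasMFDerivAt_of_hasDerivAt_chart hca hsrc
        (w := chartRep v x (β (extChartAt (𝓡 n) x y, t))) (by
          refine hd.congr_of_eventuallyEq ?_
          filter_upwards [hd.continuousAt.preimage_mem_nhds
            ((isOpen_extChartAt_target (I := 𝓡 n) x).mem_nhds htt)] with s hs
          exact (extChartAt (𝓡 n) x).right_inv hs)
      have h2 := coordChange_coordChange
        (mem_extChartAt_source (I := 𝓡 n) ((extChartAt (𝓡 n) x).symm
          (β (extChartAt (𝓡 n) x y, t)))) hsrc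
        (v ((extChartAt (𝓡 n) x).symm (β (extChartAt (𝓡 n) x y, t))))
      unfold chartRep at h1
      exact (h1.congr_mfderiv (congrArg _ h2)).hasMFDerivWithinAt
  · refine ContinuousOn.comp (t := (extChartAt (𝓡 n) x).target) (continuousOn_extChartAt_symm x)
      (ContinuousOn.comp (t := Metric.closedBall z₀ r ×ˢ Icc (-ε) ε) hβc ?_ ?_) ?_
    · refine ContinuousOn.prodMk ?_ continuous_snd.continuousOn
      exact (continuousOn_extChartAt x).comp continuous_fst.continuousOn fun q hq => hq.1.1
    · exact fun q hq => ⟨hq.1.2.2, Ioo_subset_Icc_self (hin _ hq.2).2⟩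
    · exact fun q hq => hab hq.1.2.1 (hin _ hq.2).1

variable [T2Space M] [CompactSpace M]

theorem exists_continuous_flow
    (hv : ContMDiff (𝓡 n) (𝓡 n).tangent 1 (fun y => (⟨y, v y⟩ : TangentBundle (𝓡 n) M))) :
    ∃ φ : ℝ → M → M, (∀ y, φ 0 y = y) ∧ (∀ y, IsMIntegralCurve (I := 𝓡 n) (fun t => φ t y) v) ∧
      Continuous fun q : ℝ × M => φ q.1 q.2 := by
  -- Compactness gives one existence time for all starting points, which makes every solution
  -- global.
  have hunif : ∃ ε > (0 : ℝ), ∀ y ∈ (univ : Set M), ∃ γ : ℝ → M, γ 0 = y ∧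
      IsMIntegralCurveOn γ v (Ioo (-ε) ε) := by
    refine isCompact_univ.induction_on (p := fun s => ∃ ε > (0 : ℝ), ∀ y ∈ s, ∃ γ : ℝ → M,
      γ 0 = y ∧ IsMIntegralCurveOn γ v (Ioo (-ε) ε)) ⟨1, one_pos, by simp⟩ ?_ ?_ ?_
    · rintro s t hst ⟨ε, hε, h⟩
      exact ⟨ε, hε, fun y hy => h y (hst hy)⟩
    · rintro s t ⟨ε, hε, h⟩ ⟨δ, hδ, h'⟩
      refine ⟨min ε δ, lt_min hε hδ, ?_⟩
      rintro y (hy | hy)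
      · obtain ⟨γ, h0, hγ⟩ := h y hy
        exact ⟨γ, h0, hγ.mono (Ioo_subset_Ioo (neg_le_neg (min_le_left _ _)) (min_le_left _ _))⟩
      · obtain ⟨γ, h0, hγ⟩ := h' y hy
        exact ⟨γ, h0, hγ.mono (Ioo_subset_Ioo (neg_le_neg (min_le_right _ _)) (min_le_right _ _))⟩
    · intro x _
      obtain ⟨ε, hε, U, hU, α, hα, -⟩ := exists_local_flow hv x
      exact ⟨U, mem_nhdsWithin_of_mem_nhds hU, ε, hε, fun y hy => ⟨fun t => α (y, t), hα y hy⟩⟩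
  obtain ⟨ε, hε, hγ⟩ := hunif
  choose Φ hΦ0 hΦ using fun y =>
    exists_isMIntegralCurve_of_isMIntegralCurveOn hv hε (fun x => hγ x (mem_univ x)) y
  have hadd : ∀ s t y, Φ y (t + s) = Φ (Φ y s) t := by
    intro s t y
    have := isMIntegralCurve_Ioo_eq_of_contMDiff_boundaryless (t₀ := 0) hv ((hΦ y).comp_add s)
      (hΦ (Φ y s)) (by simp [hΦ0])
    exact congrFun this t
  -- By uniqueness the global solutions agree for short times with the local flows, which are
  -- jointly continuous; compactness again makes the time uniform.
  have hloc : ∃ δ > (0 : ℝ), ∀ y ∈ (univ : Set M), ∀ t ∈ Ioo (-δ) δ,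
      ContinuousAt (fun q : ℝ × M => Φ q.2 q.1) (t, y) := by
    refine isCompact_univ.induction_on (p := fun s => ∃ δ > (0 : ℝ), ∀ y ∈ s, ∀ t ∈ Ioo (-δ) δ,
      ContinuousAt (fun q : ℝ × M => Φ q.2 q.1) (t, y)) ⟨1, one_pos, by simp⟩ ?_ ?_ ?_
    · rintro s t hst ⟨ε, hε, h⟩
      exact ⟨ε, hε, fun y hy => h y (hst hy)⟩
    · rintro s t ⟨ε, hε, h⟩ ⟨δ, hδ, h'⟩
      refine ⟨min ε δ, lt_min hε hδ, ?_⟩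
      rintro y (hy | hy) t ht
      · exact h y hy t (Ioo_subset_Ioo (neg_le_neg (min_le_left _ _)) (min_le_left _ _) ht)
      · exact h' y hy t (Ioo_subset_Ioo (neg_le_neg (min_le_right _ _)) (min_le_right _ _) ht)
    · intro x _
      obtain ⟨δ, hδ, U, hU, α, hα, hαc⟩ := exists_local_flow hv x
      obtain ⟨V, hVU, hVo, hxV⟩ := mem_nhds_iff.1 hU
      refine ⟨V, mem_nhdsWithin_of_mem_nhds (hVo.mem_nhds hxV), δ, hδ, fun y hy t ht => ?_⟩
      have h1 : ContinuousAt (fun q : ℝ × M => α (q.2, q.1)) (t, y) :=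
        ContinuousAt.comp (g := α) (f := Prod.swap) (x := (t, y))
          (hαc.continuousAt (prod_mem_nhds (mem_of_superset (hVo.mem_nhds hy) hVU)
            (Ioo_mem_nhds ht.1 ht.2))) continuous_swap.continuousAt
      refine h1.congr ?_
      filter_upwards [prod_mem_nhds (Ioo_mem_nhds ht.1 ht.2) (hVo.mem_nhds hy)] with q hq
      have h2 := isMIntegralCurveOn_Ioo_eqOn_of_contMDiff_boundaryless (t₀ := 0)
        (a := -δ) (b := δ) ⟨by linarith, hδ⟩ hv (hα q.2 (hVU hq.2)).2
        ((hΦ q.2).isMIntegralCurveOn _) (by rw [(hα q.2 (hVU hq.2)).1, hΦ0])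
      exact h2 hq.1
  obtain ⟨δ, hδ, hc⟩ := hloc
  have hsmall : ∀ t ∈ Ioo (-δ) δ, Continuous fun y => Φ y t := by
    intro t ht
    refine continuous_iff_continuousAt.2 fun y => ?_
    exact ContinuousAt.comp (g := fun q : ℝ × M => Φ q.2 q.1) (f := fun y => (t, y)) (x := y)
      (hc y (mem_univ y) t ht) (Continuous.prodMk_right t).continuousAt
  have hmul : ∀ (N : ℕ), ∀ t ∈ Ioo (-δ) δ, Continuous fun y => Φ y (N * t) := by
    intro N t ht
    induction N with
    | zero => simpa [hΦ0] using! continuous_id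
    | succ k ih =>
      have : (fun y => Φ y ((k + 1 : ℕ) * t)) = fun y => Φ (Φ y (k * t)) t := by
        funext y
        rw [← hadd]
        congr 1
        push_cast
        ring
      rw [this]
      exact (hsmall t ht).comp ih
  have hall : ∀ t, Continuous fun y => Φ y t := by
    intro t
    obtain ⟨N, hN⟩ := exists_nat_gt (|t| / δ)
    have hN0 : (0 : ℝ) < N := lt_of_le_of_lt (by positivity) hN
    have h1 : |t / N| < δ := by
      rw [abs_div, abs_of_pos hN0, div_lt_iff₀ hN0]
      rw [div_lt_iff₀ hδ] at hN
      linarith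
    have h2 := hmul N (t / N) (abs_lt.1 h1)
    rwa [mul_div_cancel₀ _ hN0.ne'] at h2
  refine ⟨fun t y => Φ y t, hΦ0, hΦ, continuous_iff_continuousAt.2 ?_⟩
  rintro ⟨T, y⟩
  -- Near time `T`, flow first for the short time `q.1 - T` and then for the fixed time `T`.
  have h1 : (fun q : ℝ × M => Φ q.2 q.1) = fun q => Φ (Φ q.2 (q.1 - T)) T := by
    funext q
    rw [← hadd]
    congr 1
    ring
  change ContinuousAt (fun q : ℝ × M => Φ q.2 q.1) (T, y)
  rw [h1]
  refine (hall T).continuousAt.comp (f := fun q : ℝ × M => Φ q.2 (q.1 - T)) ?_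
  refine ContinuousAt.comp (g := fun q : ℝ × M => Φ q.2 q.1)
    (f := fun q : ℝ × M => (q.1 - T, q.2)) ?_ ?_
  · simp only [sub_self]
    exact hc y (mem_univ y) 0 ⟨by linarith, hδ⟩
  · fun_prop

end Flow

/-! ### Behaviour of gradient orbits; stable manifolds of minima. -/

section GradFlow

variable {n : ℕ} {M : Type*} [TopologicalSpace M] [ChartedSpace (EuclideanSpace ℝ (Fin n)) M]

theorem isCriticalPoint_of_isLocalExtr {f : M → ℝ} (hf : ContMDiff (𝓡 n) 𝓘(ℝ, ℝ) ∞ f) {x : M}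
    (hx : IsLocalExtr f x) : IsCriticalPoint (n := n) f x := by
  have h1 : IsLocalExtr (f ∘ (extChartAt (𝓡 n) x).symm) (extChartAt (𝓡 n) x x) := by
    have hc := continuousAt_extChartAt_symm (I := 𝓡 n) x
    have hx' : (extChartAt (𝓡 n) x).symm (extChartAt (𝓡 n) x x) = x :=
      (extChartAt (𝓡 n) x).left_inv (mem_extChartAt_source x)
    rcases hx with hx | hx
    · left
      have h2 : ∀ᶠ z in 𝓝 (extChartAt (𝓡 n) x x), f x ≤ f ((extChartAt (𝓡 n) x).symm z) := by
        refine hc.eventually (p := fun y => f x ≤ f y) ?_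
        rw [hx']
        exact hx
      filter_upwards [h2] with z hz
      simpa only [Function.comp_apply, hx'] using hz
    · right
      have h2 : ∀ᶠ z in 𝓝 (extChartAt (𝓡 n) x x), f ((extChartAt (𝓡 n) x).symm z) ≤ f x := by
        refine hc.eventually (p := fun y => f y ≤ f x) ?_
        rw [hx']
        exact hx
      filter_upwards [h2] with z hz
      simpa only [Function.comp_apply, hx'] using hz
  have h3 := h1.fderiv_eq_zero
  have h4 := hf.mdifferentiable (by simp) x
  have h5 := h4.mfderiv
  unfold IsCriticalPoint
  rw [h5, ModelWithCorners.range_eq_univ, fderivWithin_univ]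
  exact h3

variable [IsManifold (𝓡 n) ∞ M]

/-- `φ` is the global, continuous negative gradient flow of `f`, and its orbits are the only flow
lines. -/
structure IsGradFlow (g : Metric n M) (f : M → ℝ) (φ : ℝ → M → M) : Prop where
  zero : ∀ y, φ 0 y = y
  line : ∀ y, IsFlowLine g f (fun t => φ t y)
  cont : Continuous fun q : ℝ × M => φ q.1 q.2
  unique : ∀ γ, IsFlowLine g f γ → ∀ t, γ t = φ t (γ 0)

theorem exists_isGradFlow [T2Space M] [CompactSpace M] (g : Metric n M) {f : M → ℝ}
    (hf : ContMDiff (𝓡 n) 𝓘(ℝ, ℝ) ∞ f) : ∃ φ, IsGradFlow g f φ := by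
  obtain ⟨φ, h0, h1, h2⟩ := exists_continuous_flow (contMDiff_neg_grad g hf)
  refine ⟨φ, h0, h1, h2, fun γ hγ t => ?_⟩
  exact congrFun (isMIntegralCurve_Ioo_eq_of_contMDiff_boundaryless (t₀ := 0)
    (contMDiff_neg_grad g hf) hγ (h1 (γ 0)) (h0 _).symm) t

/-- Applied to half-orbits: an orbit can leave `W` only through its frontier. -/
theorem subset_of_disjoint_frontier {X : Type*} [TopologicalSpace X] {S W : Set X}
    (hS : IsPreconnected S) (hd : ∀ x ∈ S, x ∉ frontier W) (hne : (S ∩ W).Nonempty) : S ⊆ W := by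
  have h1 : S ⊆ interior W ∪ (closure W)ᶜ := by
    intro x hx
    by_cases h : x ∈ closure W
    · exact Or.inl (by_contra fun h' => hd x hx ⟨h, h'⟩)
    · exact Or.inr h
  have h2 : (S ∩ interior W).Nonempty := by
    obtain ⟨x, hx, hw⟩ := hne
    exact ⟨x, hx, (h1 hx).resolve_right fun h => h (subset_closure hw)⟩
  exact (hS.subset_left_of_subset_union isOpen_interior isClosed_closure.isOpen_compl
    (disjoint_compl_right.mono_left (interior_subset.trans subset_closure)) h1 h2).trans
    interior_subset

namespace IsGradFlow

variable {g : Metric n M} {f : M → ℝ} {φ : ℝ → M → M} (hφ : IsGradFlow g f φ)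

include hφ

theorem add (s t : ℝ) (y : M) : φ (s + t) y = φ s (φ t y) := by
  have h := hφ.unique (fun s => φ (s + t) y) ((hφ.line y).comp_add t) s
  simpa using h

theorem continuous_time (y : M) : Continuous fun t => φ t y :=
  hφ.cont.comp (Continuous.prodMk_left y)

theorem continuous_space (t : ℝ) : Continuous (φ t) :=
  hφ.cont.comp (Continuous.prodMk_right t)

theorem neg_apply_self (t : ℝ) (y : M) : φ (-t) (φ t y) = y := by
  rw [← hφ.add, neg_add_cancel, hφ.zero]

theorem mem_stable_iff {p y : M} : y ∈ stable g f p ↔ Tendsto (fun t => φ t y) atTop (𝓝 p) := by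
  constructor
  · rintro ⟨γ, hγ, rfl, ht⟩
    exact ht.congr fun t => hφ.unique γ hγ t
  · exact fun h => ⟨_, hφ.line y, hφ.zero y, h⟩

theorem mem_unstable_iff {p y : M} :
    y ∈ unstable g f p ↔ Tendsto (fun t => φ t y) atBot (𝓝 p) := by
  constructor
  · rintro ⟨γ, hγ, rfl, ht⟩
    exact ht.congr fun t => hφ.unique γ hγ t
  · exact fun h => ⟨_, hφ.line y, hφ.zero y, h⟩

theorem apply_mem_stable_iff {p y : M} (s : ℝ) : φ s y ∈ stable g f p ↔ y ∈ stable g f p := by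
  rw [hφ.mem_stable_iff, hφ.mem_stable_iff]
  simp_rw [← hφ.add]
  exact ⟨fun h => (h.comp (tendsto_atTop_add_const_right atTop (-s) tendsto_id)).congr
      fun t => by simp,
    fun h => h.comp (tendsto_atTop_add_const_right atTop s tendsto_id)⟩

theorem apply_of_isCriticalPoint {y : M} (hy : IsCriticalPoint (n := n) f y) (t : ℝ) :
    φ t y = y := by
  have h : -grad g f y = 0 := by rw [(grad_eq_zero_iff g f y).2 hy, neg_zero]
  exact (hφ.unique (fun _ => y) (isMIntegralCurve_const (v := fun x => -grad g f x) h) t).symm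

theorem isCriticalPoint_of_apply {y : M} {t : ℝ} (hy : IsCriticalPoint (n := n) f (φ t y)) :
    IsCriticalPoint (n := n) f y := by
  have h := hφ.apply_of_isCriticalPoint hy (-t)
  rw [hφ.neg_apply_self] at h
  rwa [h]

theorem hasDerivAt_comp (hf : ContMDiff (𝓡 n) 𝓘(ℝ, ℝ) ∞ f) (y : M) (t : ℝ) :
    HasDerivAt (fun t => f (φ t y))
      (-g.inner (φ t y) (grad g f (φ t y)) (grad g f (φ t y))) t := by
  have h1 := (hf.mdifferentiable (by simp) (φ t y)).hasMFDerivAt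
  let L : EuclideanSpace ℝ (Fin n) →L[ℝ] ℝ := mfderiv (𝓡 n) 𝓘(ℝ, ℝ) f (φ t y)
  let w : EuclideanSpace ℝ (Fin n) := -grad g f (φ t y)
  have h2 : HasFDerivAt (fun t => f (φ t y)) (L.comp ((1 : ℝ →L[ℝ] ℝ).smulRight w)) t :=
    (HasMFDerivAt.comp t h1 (hφ.line y t)).hasFDerivAt
  refine h2.hasDerivAt.congr_deriv ?_
  have h3 := inner_grad g f (φ t y) (-grad g f (φ t y))
  have h4 : g.inner (φ t y) (grad g f (φ t y)) (-grad g f (φ t y)) =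
    -g.inner (φ t y) (grad g f (φ t y)) (grad g f (φ t y)) := map_neg _ _
  rw [← h4, h3]
  exact congrArg (mfderiv (𝓡 n) 𝓘(ℝ, ℝ) f (φ t y)) (one_smul ℝ (-grad g f (φ t y)))

theorem antitone (hf : ContMDiff (𝓡 n) 𝓘(ℝ, ℝ) ∞ f) (y : M) : Antitone fun t => f (φ t y) := by
  refine antitone_of_deriv_nonpos (fun t => (hφ.hasDerivAt_comp hf y t).differentiableAt) ?_
  intro t
  rw [(hφ.hasDerivAt_comp hf y t).deriv, neg_nonpos]
  by_cases h : grad g f (φ t y) = 0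
  · rw [h]
    exact le_of_eq (map_zero _).symm
  · exact (g.pos _ _ h).le

/-- The derivative of `f` along an orbit is minus the squared length of the gradient, and the orbit
of a regular point contains no critical point. -/
theorem strictAnti (hf : ContMDiff (𝓡 n) 𝓘(ℝ, ℝ) ∞ f) {y : M}
    (hy : ¬ IsCriticalPoint (n := n) f y) : StrictAnti fun t => f (φ t y) := by
  refine strictAnti_of_deriv_neg ?_
  intro t
  rw [(hφ.hasDerivAt_comp hf y t).deriv, neg_lt_zero]
  exact g.pos _ _ fun h => hy (hφ.isCriticalPoint_of_apply ((grad_eq_zero_iff g f _).1 h))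

theorem lt_of_mem_stable (hf : ContMDiff (𝓡 n) 𝓘(ℝ, ℝ) ∞ f) {p y : M} (h : y ∈ stable g f p)
    (hy : ¬ IsCriticalPoint (n := n) f y) : f p < f y := by
  have h1 := (hf.continuous.tendsto p).comp (hφ.mem_stable_iff.1 h)
  have h2 := (hφ.antitone hf y).le_of_tendsto h1 1
  have h3 := hφ.strictAnti hf hy one_pos
  simp only [hφ.zero] at h3
  exact h2.trans_lt h3

theorem lt_of_mem_unstable (hf : ContMDiff (𝓡 n) 𝓘(ℝ, ℝ) ∞ f) {p y : M}
    (h : y ∈ unstable g f p) (hy : ¬ IsCriticalPoint (n := n) f y) : f y < f p := by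
  have h1 := (hf.continuous.tendsto p).comp (hφ.mem_unstable_iff.1 h)
  have h2 := (hφ.antitone hf y).ge_of_tendsto h1 (-1)
  have h3 := hφ.strictAnti hf hy (neg_one_lt_zero)
  simp only [hφ.zero] at h3
  exact h3.trans_le h2

theorem le_of_mem_stable (hf : ContMDiff (𝓡 n) 𝓘(ℝ, ℝ) ∞ f) {p y : M} (h : y ∈ stable g f p) :
    f p ≤ f y := by
  have h1 := (hf.continuous.tendsto p).comp (hφ.mem_stable_iff.1 h)
  have h2 := (hφ.antitone hf y).le_of_tendsto h1 0
  simpa only [hφ.zero] using h2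

theorem eq_of_mem_stable [T2Space M] {p y : M} (h : y ∈ stable g f p)
    (hy : IsCriticalPoint (n := n) f y) : y = p := by
  have h1 := hφ.mem_stable_iff.1 h
  simp only [hφ.apply_of_isCriticalPoint hy] at h1
  exact tendsto_nhds_unique tendsto_const_nhds h1

theorem eq_of_mem_unstable [T2Space M] {p y : M} (h : y ∈ unstable g f p)
    (hy : IsCriticalPoint (n := n) f y) : y = p := by
  have h1 := hφ.mem_unstable_iff.1 h
  simp only [hφ.apply_of_isCriticalPoint hy] at h1
  exact tendsto_nhds_unique tendsto_const_nhds h1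

theorem forall_mem_of_forall_notMem_frontier {W : Set M} {y : M}
    (hW : ∀ t, 0 ≤ t → φ t y ∉ frontier W) (hne : ∃ t, 0 ≤ t ∧ φ t y ∈ W) (t : ℝ) (ht : 0 ≤ t) :
    φ t y ∈ W := by
  refine subset_of_disjoint_frontier
    (isPreconnected_Ici.image (fun t => φ t y) (hφ.continuous_time y).continuousOn (s := Ici 0))
    ?_ ?_ (mem_image_of_mem _ ht)
  · rintro _ ⟨s, hs, rfl⟩
    exact hW s hs
  · obtain ⟨s, hs, h⟩ := hne
    exact ⟨_, mem_image_of_mem _ hs, h⟩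

variable [CompactSpace M]

/-- An orbit that stays in a closed set with a single critical point converges to that point. -/
theorem mem_stable_of_forall_mem (hf : ContMDiff (𝓡 n) 𝓘(ℝ, ℝ) ∞ f) {K : Set M}
    (hK : IsClosed K) {p y : M} (hp : ∀ z ∈ K, IsCriticalPoint (n := n) f z → z = p)
    (hy : ∀ t, 0 ≤ t → φ t y ∈ K) : y ∈ stable g f p := by
  rw [hφ.mem_stable_iff]
  have hbdd : BddBelow (range fun t => f (φ t y)) :=
    (isCompact_range hf.continuous).bddBelow.mono (range_subset_iff.2 fun t => mem_range_self _)
  have hL := tendsto_atTop_ciInf (hφ.antitone hf y) hbdd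
  set L := ⨅ t, f (φ t y)
  have hval : ∀ (w : M) (u : ℝ → M), MapClusterPt w atTop u → Tendsto (f ∘ u) atTop (𝓝 L) →
      f w = L := by
    intro w u hw hu
    have h1 : MapClusterPt (f w) atTop (f ∘ u) := hw.continuousAt_comp hf.continuous.continuousAt
    exact eq_of_nhds_neBot (h1.clusterPt.mono hu)
  refine hK.isCompact.tendsto_nhds_of_unique_mapClusterPt
    ((eventually_ge_atTop 0).mono hy) fun z hz hcl => hp z hz ?_
  -- LaSalle's argument: if `z` is a cluster point of the orbit, so is `φ 1 z` of the shifted orbit,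
  -- and `f` takes the limit value at both. Since `f` strictly decreases along regular orbits, `z`
  -- is critical.
  have h1 := hval z _ hcl hL
  have h2 := hval (φ 1 z) (φ 1 ∘ fun t => φ t y)
    (hcl.continuousAt_comp (hφ.continuous_space 1).continuousAt)
    ((hL.comp (tendsto_atTop_add_const_left atTop 1 tendsto_id)).congr fun t => by
      simp [hφ.add])
  by_contra hne
  have h3 := hφ.strictAnti hf hne one_pos
  simp only [hφ.zero] at h3
  linarith

/-- Points of the stable manifold with a low value of `f` never leave a given neighbourhood. -/
theorem exists_forall_mem_of_lt (hf : ContMDiff (𝓡 n) 𝓘(ℝ, ℝ) ∞ f) {p : M} {W : Set M}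
    (hW : W ∈ 𝓝 p) (hfr : ∀ z ∈ frontier W, ¬ IsCriticalPoint (n := n) f z) :
    ∃ δ > 0, ∀ y ∈ stable g f p, f y < f p + δ → ∀ t, 0 ≤ t → φ t y ∈ W := by
  -- `δ` is the least drop of `f` in unit time from the frontier. An orbit starting below `f p + δ`
  -- and meeting the frontier would fall below `f p`, impossible if it tends to `p`.
  obtain ⟨δ, hδ, hmin⟩ : ∃ δ > 0, ∀ z ∈ frontier W, δ ≤ f z - f (φ 1 z) := by
    rcases (frontier W).eq_empty_or_nonempty with h | h
    · exact ⟨1, one_pos, by simp [h]⟩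
    · obtain ⟨z, hz, hm⟩ := isClosed_frontier.isCompact.exists_isMinOn h
        (hf.continuous.sub (hf.continuous.comp (hφ.continuous_space 1))).continuousOn
      refine ⟨f z - f (φ 1 z), ?_, fun w hw => hm hw⟩
      have h3 := hφ.strictAnti hf (hfr z hz) one_pos
      simp only [hφ.zero] at h3
      linarith
  refine ⟨δ, hδ, fun y hy hlt => hφ.forall_mem_of_forall_notMem_frontier ?_ ?_⟩
  · intro t ht hmem
    have h1 := hmin _ hmem
    have h2 := hφ.antitone hf y ht
    have h3 := hφ.le_of_mem_stable hf ((hφ.apply_mem_stable_iff 1).2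
      ((hφ.apply_mem_stable_iff t).2 hy))
    simp only [hφ.zero] at h2
    linarith
  · obtain ⟨t, ht, h⟩ := ((eventually_ge_atTop (0 : ℝ)).and
      ((hφ.mem_stable_iff.1 hy).eventually hW)).exists
    exact ⟨t, ht, h⟩

variable [T2Space M]

/-- On a small closed neighbourhood the frontier lies strictly above the level of the minimum, so
orbits starting low enough are trapped there, with only one critical point to converge to. -/
theorem stable_mem_nhds_self (hf : IsMorse n f) {q : M} (hq : IsLocalMin f q) :
    stable g f q ∈ 𝓝 q := by
  have hcrit := isCriticalPoint_of_isLocalExtr hf.smooth (Or.inl hq)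
  have h1 := eventually_nhdsWithin_iff.1 (eventually_not_isCriticalPoint hf hcrit)
  obtain ⟨V, hV, hVo, hqV⟩ := mem_nhds_iff.1 (h1.and hq)
  obtain ⟨W, hW, hWc, hWV⟩ := exists_mem_nhds_isClosed_subset (hVo.mem_nhds hqV)
  -- Another point at the same level would itself be a local minimum, hence a second critical point
  -- in `V`.
  have hstrict : ∀ y ∈ V, y ≠ q → f q < f y := by
    intro y hy hne
    refine lt_of_le_of_ne (hV hy).2 fun heq => (hV hy).1 hne ?_
    refine isCriticalPoint_of_isLocalExtr hf.smooth (Or.inl ?_)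
    filter_upwards [hVo.mem_nhds hy] with w hw
    rw [← heq]
    exact (hV hw).2
  obtain ⟨m, hm, hmin⟩ : ∃ m, f q < m ∧ ∀ z ∈ frontier W, m ≤ f z := by
    rcases (frontier W).eq_empty_or_nonempty with h | h
    · exact ⟨f q + 1, by linarith, by simp [h]⟩
    · obtain ⟨z, hz, hm⟩ := isClosed_frontier.isCompact.exists_isMinOn h hf.smooth.continuous.continuousOn
      refine ⟨f z, hstrict z (hWV (hWc.frontier_subset hz)) ?_, fun w hw => hm hw⟩
      rintro rfl
      exact hz.2 (mem_interior_iff_mem_nhds.2 hW)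
  filter_upwards [hW, hf.smooth.continuous.continuousAt.eventually (gt_mem_nhds hm)] with y hyW hym
  refine hφ.mem_stable_of_forall_mem hf.smooth hWc ?_
    (hφ.forall_mem_of_forall_notMem_frontier ?_ ⟨0, le_rfl, by rwa [hφ.zero]⟩)
  · intro z hz hc
    by_contra hne
    exact (hV (hWV hz)).1 hne hc
  · intro t ht hmem
    have h2 := hφ.antitone hf.smooth y ht
    simp only [hφ.zero] at h2
    linarith [hmin _ hmem]

/-- The stable manifold of a local minimum is open. -/
theorem stable_mem_nhds (hf : IsMorse n f) {q : M} (hq : IsLocalMin f q) {x : M}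
    (hx : x ∈ stable g f q) : stable g f q ∈ 𝓝 x := by
  obtain ⟨t, ht⟩ := ((hφ.mem_stable_iff.1 hx).eventually
    (eventually_mem_nhds_iff.2 (hφ.stable_mem_nhds_self hf hq))).exists
  filter_upwards [(hφ.continuous_space t).continuousAt.preimage_mem_nhds ht] with y hy
  exact (hφ.apply_mem_stable_iff t).1 hy

end IsGradFlow

end GradFlow

/-! ### Hyperbolic splittings of linear maps, and a second-order test for minima. -/

section SaddleFrames

/-- Along a segment from `z₀` in direction `v`, the derivative at time `t` differs from `t * B v v`
by at most `t * (c * ‖v‖ ^ 2)`, so coercivity makes the function increase. -/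
theorem isLocalMin_of_hasFDerivAt_fderiv {E : Type*} [NormedAddCommGroup E] [NormedSpace ℝ E]
    {F : E → ℝ} {z₀ : E} {B : E →L[ℝ] E →L[ℝ] ℝ} {c : ℝ} (hc : 0 < c)
    (hF : ∀ᶠ z in 𝓝 z₀, DifferentiableAt ℝ F z) (h0 : fderiv ℝ F z₀ = 0)
    (hB : HasFDerivAt (fderiv ℝ F) B z₀) (hpos : ∀ v, c * ‖v‖ ^ 2 ≤ B v v) : IsLocalMin F z₀ := by
  have h1 := hB.isLittleO.def hc
  obtain ⟨r, hr, hball⟩ := Metric.eventually_nhds_iff_ball.1 (hF.and h1)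
  filter_upwards [Metric.ball_mem_nhds z₀ hr] with z hz
  have hseg : ∀ t ∈ Icc (0 : ℝ) 1, z₀ + t • (z - z₀) ∈ Metric.ball z₀ r := by
    intro t ht
    rw [Metric.mem_ball, dist_eq_norm] at hz ⊢
    rw [add_sub_cancel_left, norm_smul, Real.norm_eq_abs, abs_of_nonneg ht.1]
    exact lt_of_le_of_lt (mul_le_of_le_one_left (norm_nonneg _) ht.2) hz
  have hder : ∀ t ∈ Icc (0 : ℝ) 1, HasDerivAt (fun t : ℝ => F (z₀ + t • (z - z₀)))
      (fderiv ℝ F (z₀ + t • (z - z₀)) (z - z₀)) t := by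
    intro t ht
    have h2 := (hball _ (hseg t ht)).1.hasFDerivAt
    have h3 : HasDerivAt (fun t : ℝ => z₀ + t • (z - z₀)) (z - z₀) t := by
      simpa using ((hasDerivAt_id t).smul_const (z - z₀)).const_add z₀
    exact h2.comp_hasDerivAt t h3
  have hmono : MonotoneOn (fun t : ℝ => F (z₀ + t • (z - z₀))) (Icc 0 1) := by
    refine monotoneOn_of_deriv_nonneg (convex_Icc 0 1)
      (fun t ht => (hder t ht).continuousAt.continuousWithinAt)
      (fun t ht => (hder t (interior_subset ht)).differentiableAt.differentiableWithinAt) ?_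
    intro t ht
    have ht' : t ∈ Icc (0 : ℝ) 1 := interior_subset ht
    rw [(hder t ht').deriv]
    have h4 := (hball _ (hseg t ht')).2
    rw [h0, sub_zero, add_sub_cancel_left] at h4
    rw [interior_Icc] at ht
    have h5 := (fderiv ℝ F (z₀ + t • (z - z₀)) - B (t • (z - z₀))).le_opNorm (z - z₀)
    have h6 : ‖t • (z - z₀)‖ = t * ‖z - z₀‖ := by
      rw [norm_smul, Real.norm_eq_abs, abs_of_nonneg ht'.1]
    have h7 := hpos (z - z₀)
    rw [h6] at h4
    have h8 : ‖fderiv ℝ F (z₀ + t • (z - z₀)) - B (t • (z - z₀))‖ * ‖z - z₀‖ ≤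
        t * (c * ‖z - z₀‖ ^ 2) := by
      calc _ ≤ c * (t * ‖z - z₀‖) * ‖z - z₀‖ := by gcongr
        _ = _ := by ring
    have h9 := neg_abs_le ((fderiv ℝ F (z₀ + t • (z - z₀)) - B (t • (z - z₀))) (z - z₀))
    rw [← Real.norm_eq_abs] at h9
    have h10 : (fderiv ℝ F (z₀ + t • (z - z₀)) - B (t • (z - z₀))) (z - z₀) =
        fderiv ℝ F (z₀ + t • (z - z₀)) (z - z₀) - t * B (z - z₀) (z - z₀) := by
      simp
    have h11 : t * (c * ‖z - z₀‖ ^ 2) ≤ t * B (z - z₀) (z - z₀) :=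
      mul_le_mul_of_nonneg_left h7 ht'.1
    linarith
  have := hmono ⟨le_rfl, zero_le_one⟩ ⟨zero_le_one, le_rfl⟩ zero_le_one
  simpa using this

/-- A splitting of a linear map of a space into a contracting and an expanding direction. -/
structure SaddleFrame {E : Type*} [NormedAddCommGroup E] [NormedSpace ℝ E] (A : E →L[ℝ] E) where
  (lam mu : ℝ)
  (es eu : E)
  (s u : E →L[ℝ] ℝ)
  lam_pos : 0 < lam
  mu_pos : 0 < mu
  s_es : s es = 1
  s_eu : s eu = 0
  u_es : u es = 0
  u_eu : u eu = 1
  decomp : ∀ z, s z • es + u z • eu = z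
  s_map : ∀ z, s (A z) = -lam * s z
  u_map : ∀ z, u (A z) = mu * u z

namespace SaddleFrame

variable {E : Type*} [NormedAddCommGroup E] [NormedSpace ℝ E] {A : E →L[ℝ] E}

/-- Reversing time swaps the contracting and the expanding direction. -/
def neg (S : SaddleFrame A) : SaddleFrame (-A) where
  lam := S.mu
  mu := S.lam
  es := S.eu
  eu := S.es
  s := S.u
  u := S.s
  lam_pos := S.mu_pos
  mu_pos := S.lam_pos
  s_es := S.u_eu
  s_eu := S.u_es
  u_es := S.s_eu
  u_eu := S.s_es
  decomp z := by rw [add_comm, S.decomp]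
  s_map z := by simp [S.u_map]
  u_map z := by simp [S.s_map]

/-- The frame with the contracting direction reversed. -/
def flip (S : SaddleFrame A) : SaddleFrame A where
  lam := S.lam
  mu := S.mu
  es := -S.es
  eu := S.eu
  s := -S.s
  u := S.u
  lam_pos := S.lam_pos
  mu_pos := S.mu_pos
  s_es := by simp [S.s_es]
  s_eu := by simp [S.s_eu]
  u_es := by simp [S.u_es]
  u_eu := S.u_eu
  decomp z := by simp [S.decomp]
  s_map z := by simp [S.s_map]
  u_map z := S.u_map z

theorem eq_of_coords (S : SaddleFrame A) {z w : E} (hs : S.s z = S.s w) (hu : S.u z = S.u w) :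
    z = w := by
  rw [← S.decomp z, ← S.decomp w, hs, hu]

theorem norm_le (S : SaddleFrame A) :
    ∃ C > 0, ∀ z, ‖z‖ ≤ C * (|S.s z| + |S.u z|) := by
  refine ⟨‖S.es‖ + ‖S.eu‖ + 1, by positivity, fun z => ?_⟩
  have h1 : ‖z‖ ≤ |S.s z| * ‖S.es‖ + |S.u z| * ‖S.eu‖ := by
    conv_lhs => rw [← S.decomp z]
    refine (norm_add_le _ _).trans ?_
    rw [norm_smul, norm_smul, Real.norm_eq_abs, Real.norm_eq_abs]
  nlinarith [abs_nonneg (S.s z), abs_nonneg (S.u z), norm_nonneg S.es, norm_nonneg S.eu,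
    mul_nonneg (abs_nonneg (S.s z)) (norm_nonneg S.eu),
    mul_nonneg (abs_nonneg (S.u z)) (norm_nonneg S.es)]

/-- A vector field with linearization `A` is close to `A` in the coordinates of the frame. -/
theorem eventually_coords (S : SaddleFrame A) {X : E → E} {z₀ : E} (hX : HasStrictFDerivAt X A z₀)
    {η : ℝ} (hη : 0 < η) : ∃ r > 0, ∀ z ∈ Metric.ball z₀ r, ∀ w ∈ Metric.ball z₀ r,
      |S.s (X z - X w) + S.lam * S.s (z - w)| ≤ η * (|S.s (z - w)| + |S.u (z - w)|) ∧
      |S.u (X z - X w) - S.mu * S.u (z - w)| ≤ η * (|S.s (z - w)| + |S.u (z - w)|) := by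
  obtain ⟨C, hC, hCb⟩ := S.norm_le
  set D := ‖S.s‖ + ‖S.u‖ + 1 with hD
  have hD0 : 0 < D := by positivity
  -- `C` converts the norm into frame coordinates and `D` bounds the coordinate functionals;
  -- dividing by both leaves exactly `η`.
  have h1 := hX.isLittleO.def (c := η / (C * D)) (by positivity)
  obtain ⟨r, hr, hb⟩ := Metric.eventually_nhds_iff_ball.1 h1
  refine ⟨r, hr, fun z hz w hw => ?_⟩
  have h2 : ‖X z - X w - A (z - w)‖ ≤ η / (C * D) * ‖z - w‖ :=
    hb (z, w) (by rw [← ball_prod_same]; exact ⟨hz, hw⟩)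
  have h3 := hCb (z - w)
  have key : ∀ ℓ : E →L[ℝ] ℝ, ‖ℓ‖ ≤ D →
      |ℓ (X z - X w - A (z - w))| ≤ η * (|S.s (z - w)| + |S.u (z - w)|) := by
    intro ℓ hℓ
    calc |ℓ (X z - X w - A (z - w))| ≤ ‖ℓ‖ * ‖X z - X w - A (z - w)‖ := ℓ.le_opNorm _
      _ ≤ D * (η / (C * D) * (C * (|S.s (z - w)| + |S.u (z - w)|))) := by gcongr; exact h2.trans (by gcongr)
      _ = _ := by field_simp
  constructor
  · have h4 := key S.s (by rw [hD]; linarith [norm_nonneg S.u])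
    rw [map_sub S.s (X z - X w), S.s_map] at h4
    rwa [show S.s (X z - X w) - -S.lam * S.s (z - w) = S.s (X z - X w) + S.lam * S.s (z - w) by
      ring] at h4
  · have h4 := key S.u (by rw [hD]; linarith [norm_nonneg S.s])
    rwa [map_sub S.u (X z - X w), S.u_map] at h4

end SaddleFrame

theorem exists_eigenvector {A : EuclideanSpace ℝ (Fin 2) →L[ℝ] EuclideanSpace ℝ (Fin 2)} {r : ℝ}
    (hr : (A (EuclideanSpace.single 0 1) 0 - r) * (A (EuclideanSpace.single 1 1) 1 - r) -
      A (EuclideanSpace.single 1 1) 0 * A (EuclideanSpace.single 0 1) 1 = 0) :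
    ∃ e ≠ 0, A e = r • e := by
  set a := A (EuclideanSpace.single 0 1) 0
  set b := A (EuclideanSpace.single 1 1) 0
  set c := A (EuclideanSpace.single 0 1) 1
  set d := A (EuclideanSpace.single 1 1) 1
  have hdet : (!![a - r, b; c, d - r]).det = 0 := by
    rw [Matrix.det_fin_two_of]
    exact hr
  obtain ⟨v, hv, hv0⟩ := Matrix.exists_mulVec_eq_zero_iff.2 hdet
  refine ⟨WithLp.toLp 2 v, fun h => hv (by simpa using h), ?_⟩
  have h0 := congrFun hv0 0
  have h1 := congrFun hv0 1
  simp [Matrix.mulVec, dotProduct, Fin.sum_univ_two] at h0 h1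
  have h3 : WithLp.toLp 2 v = v 0 • EuclideanSpace.single 0 (1 : ℝ) +
      v 1 • EuclideanSpace.single 1 (1 : ℝ) := by
    ext k
    fin_cases k <;> simp
  have h4 : A (WithLp.toLp 2 v) = v 0 • A (EuclideanSpace.single 0 (1 : ℝ)) +
      v 1 • A (EuclideanSpace.single 1 (1 : ℝ)) := by
    rw [h3, map_add, map_smul, map_smul]
  rw [h4]
  ext k
  fin_cases k
  · change v 0 * a + v 1 * b = r * v 0
    linarith
  · change v 0 * c + v 1 * d = r * v 1
    linarith

/-- A negative determinant makes the square root of the discriminant exceed the absolute value of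
the trace, so the eigenvalues are real and of opposite signs. -/
theorem nonempty_saddleFrame {A : EuclideanSpace ℝ (Fin 2) →L[ℝ] EuclideanSpace ℝ (Fin 2)}
    (hA : A (EuclideanSpace.single 0 1) 0 * A (EuclideanSpace.single 1 1) 1 -
      A (EuclideanSpace.single 1 1) 0 * A (EuclideanSpace.single 0 1) 1 < 0) :
    Nonempty (SaddleFrame A) := by
  set a := A (EuclideanSpace.single 0 1) 0 with ha
  set b := A (EuclideanSpace.single 1 1) 0 with hb
  set c := A (EuclideanSpace.single 0 1) 1 with hc
  set d := A (EuclideanSpace.single 1 1) 1 with hd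
  have hdisc : 0 ≤ (a + d) ^ 2 - 4 * (a * d - b * c) := by nlinarith [sq_nonneg (a + d)]
  set q := √((a + d) ^ 2 - 4 * (a * d - b * c)) with hq
  have hqq : q * q = (a + d) ^ 2 - 4 * (a * d - b * c) := Real.mul_self_sqrt hdisc
  have hq0 : 0 ≤ q := Real.sqrt_nonneg _
  have hqad : |a + d| < q := by
    apply abs_lt_of_sq_lt_sq _ hq0
    nlinarith
  obtain ⟨e₁, he₁, hA₁⟩ := exists_eigenvector (A := A) (r := (a + d - q) / 2) (by
    rw [← ha, ← hb, ← hc, ← hd]; nlinarith)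
  obtain ⟨e₂, he₂, hA₂⟩ := exists_eigenvector (A := A) (r := (a + d + q) / 2) (by
    rw [← ha, ← hb, ← hc, ← hd]; nlinarith)
  have hlam : 0 < -((a + d - q) / 2) := by linarith [le_abs_self (a + d)]
  have hmu : 0 < (a + d + q) / 2 := by linarith [neg_abs_le (a + d)]
  set l := (a + d - q) / 2
  set m := (a + d + q) / 2
  have hli : LinearIndependent ℝ ![e₁, e₂] := by
    rw [LinearIndependent.pair_iff]
    intro x y hxy
    have h1 : x • l • e₁ + y • m • e₂ = 0 := by
      rw [← hA₁, ← hA₂, ← map_smul, ← map_smul, ← map_add, hxy, map_zero]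
    have h2 : (y * (m - l)) • e₂ = 0 := by
      calc (y * (m - l)) • e₂ = (x • l • e₁ + y • m • e₂) - l • (x • e₁ + y • e₂) := by module
        _ = 0 := by rw [h1, hxy, smul_zero, sub_zero]
    have hy : y = 0 := by
      have := (smul_eq_zero.1 h2).resolve_right he₂
      exact (mul_eq_zero.1 this).resolve_right (by linarith)
    rw [hy, zero_smul, add_zero] at hxy
    exact ⟨(smul_eq_zero.1 hxy).resolve_right he₁, hy⟩
  let B := basisOfLinearIndependentOfCardEqFinrank hli (by simp)
  have hB0 : B 0 = e₁ := by simp [B]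
  have hB1 : B 1 = e₂ := by simp [B]
  have hdec : ∀ z, B.coord 0 z • e₁ + B.coord 1 z • e₂ = z := by
    intro z
    have := B.sum_repr z
    rw [Fin.sum_univ_two, hB0, hB1] at this
    exact this
  have hc : ∀ (i : Fin 2) z, B.coord i (A z) =
      B.coord 0 z * l * B.coord i e₁ + B.coord 1 z * m * B.coord i e₂ := by
    intro i z
    conv_lhs => rw [← hdec z]
    rw [map_add, map_smul, map_smul, hA₁, hA₂, map_add, map_smul, map_smul, map_smul, map_smul]
    simp only [smul_eq_mul]
    ring
  have h00 : B.coord 0 e₁ = 1 := by rw [← hB0]; simp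
  have h01 : B.coord 0 e₂ = 0 := by rw [← hB1]; simp
  have h10 : B.coord 1 e₁ = 0 := by rw [← hB0]; simp
  have h11 : B.coord 1 e₂ = 1 := by rw [← hB1]; simp
  exact ⟨{
    lam := -l
    mu := m
    es := e₁
    eu := e₂
    s := (B.coord 0).toContinuousLinearMap
    u := (B.coord 1).toContinuousLinearMap
    lam_pos := hlam
    mu_pos := hmu
    s_es := h00
    s_eu := h01
    u_es := h10
    u_eu := h11
    decomp := hdec
    s_map := fun z => by
      change B.coord 0 (A z) = _ * B.coord 0 z
      rw [hc, h00, h01]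
      ring
    u_map := fun z => by
      change B.coord 1 (A z) = _ * B.coord 1 z
      rw [hc, h10, h11]
      ring }⟩

end SaddleFrames

/-! ### Nondegenerate saddles of surfaces are hyperbolic. -/

section SaddlePoints

variable {M : Type*} [TopologicalSpace M] [ChartedSpace (EuclideanSpace ℝ (Fin 2)) M]

theorem isLocalMin_of_chart {n : ℕ} {M : Type*} [TopologicalSpace M]
    [ChartedSpace (EuclideanSpace ℝ (Fin n)) M] {f : M → ℝ} {p : M}
    (h : IsLocalMin (f ∘ (extChartAt (𝓡 n) p).symm) (extChartAt (𝓡 n) p p)) : IsLocalMin f p := by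
  filter_upwards [(continuousAt_extChartAt (I := 𝓡 n) p).eventually h,
    extChartAt_source_mem_nhds (I := 𝓡 n) p] with y hy hys
  simpa only [Function.comp_apply, (extChartAt (𝓡 n) p).left_inv hys,
    (extChartAt (𝓡 n) p).left_inv (mem_extChartAt_source p)] using hy

theorem fderiv_chart_eq_zero {n : ℕ} {M : Type*} [TopologicalSpace M]
    [ChartedSpace (EuclideanSpace ℝ (Fin n)) M] {f : M → ℝ}
    (hf : ContMDiff (𝓡 n) 𝓘(ℝ, ℝ) ∞ f) {p : M} (hp : IsCriticalPoint (n := n) f p) :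
    fderiv ℝ (f ∘ (extChartAt (𝓡 n) p).symm) (extChartAt (𝓡 n) p p) = 0 := by
  have h5 := (hf.mdifferentiable (by simp) p).mfderiv
  unfold IsCriticalPoint at hp
  rw [hp, ModelWithCorners.range_eq_univ, fderivWithin_univ] at h5
  exact h5.symm

theorem bilin_fin_two (B : EuclideanSpace ℝ (Fin 2) →L[ℝ] EuclideanSpace ℝ (Fin 2) →L[ℝ] ℝ)
    (v w : EuclideanSpace ℝ (Fin 2)) :
    B v w = v 0 * w 0 * B (EuclideanSpace.single 0 1) (EuclideanSpace.single 0 1) +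
      v 0 * w 1 * B (EuclideanSpace.single 0 1) (EuclideanSpace.single 1 1) +
      v 1 * w 0 * B (EuclideanSpace.single 1 1) (EuclideanSpace.single 0 1) +
      v 1 * w 1 * B (EuclideanSpace.single 1 1) (EuclideanSpace.single 1 1) := by
  have hv : ∀ v : EuclideanSpace ℝ (Fin 2), v = v 0 • EuclideanSpace.single 0 (1 : ℝ) +
      v 1 • EuclideanSpace.single 1 (1 : ℝ) := by
    intro v
    ext k
    fin_cases k <;> simp
  conv_lhs => rw [hv v, hv w]
  simp only [map_add, map_smul, add_apply, smul_apply, smul_eq_mul]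
  ring

theorem hessian_neg {n : ℕ} {M : Type*} [TopologicalSpace M]
    [ChartedSpace (EuclideanSpace ℝ (Fin n)) M] (f : M → ℝ) (p : M) :
    hessian (n := n) (fun y => -f y) p = -hessian (n := n) f p := by
  have h1 : fderiv ℝ ((fun y => -f y) ∘ (extChartAt (𝓡 n) p).symm) =
      fun z => -fderiv ℝ (f ∘ (extChartAt (𝓡 n) p).symm) z := by
    funext z
    exact fderiv_neg
  ext i j
  simp only [hessian, Matrix.of_apply, Matrix.neg_apply, h1]
  rw [fderiv_fun_neg]
  rfl

theorem isCriticalPoint_neg {n : ℕ} {M : Type*} [TopologicalSpace M]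
    [ChartedSpace (EuclideanSpace ℝ (Fin n)) M] {f : M → ℝ} {p : M} :
    IsCriticalPoint (n := n) (fun y => -f y) p ↔ IsCriticalPoint (n := n) f p := by
  have : mfderiv (𝓡 n) 𝓘(ℝ, ℝ) (fun y => -f y) p = -mfderiv (𝓡 n) 𝓘(ℝ, ℝ) f p := mfderiv_neg
  unfold IsCriticalPoint
  rw [this]
  exact neg_eq_zero

theorem IsMorse.neg {n : ℕ} {M : Type*} [TopologicalSpace M]
    [ChartedSpace (EuclideanSpace ℝ (Fin n)) M] {f : M → ℝ} (hf : IsMorse n f) :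
    IsMorse n (fun y => -f y) where
  smooth := hf.smooth.neg
  nondegenerate p hp := by
    rw [hessian_neg, Matrix.det_neg]
    exact mul_ne_zero (by simp) (hf.nondegenerate p (isCriticalPoint_neg.1 hp))

theorem isLocalExtr_neg {X : Type*} [TopologicalSpace X] {f : X → ℝ} {p : X} :
    IsLocalExtr (fun y => -f y) p ↔ IsLocalExtr f p := by
  constructor
  · rintro (h | h)
    · exact Or.inr (by simpa using h.neg)
    · exact Or.inl (by simpa using h.neg)
  · rintro (h | h)
    · exact Or.inr h.neg
    · exact Or.inl h.neg

theorem IsSaddle.neg {n : ℕ} {M : Type*} [TopologicalSpace M]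
    [ChartedSpace (EuclideanSpace ℝ (Fin n)) M] {f : M → ℝ} {p : M} (h : IsSaddle n f p) :
    IsSaddle n (fun y => -f y) p :=
  ⟨isCriticalPoint_neg.2 h.1, fun h' => h.2 (isLocalExtr_neg.1 h')⟩

variable [IsManifold (𝓡 2) ∞ M]

theorem isLocalMin_of_hessian_pos {f : M → ℝ} (hf : ContMDiff (𝓡 2) 𝓘(ℝ, ℝ) ∞ f) {p : M}
    (hp : IsCriticalPoint (n := 2) f p) (h0 : 0 < hessian (n := 2) f p 0 0)
    (hd : 0 < hessian (n := 2) f p 0 0 * hessian (n := 2) f p 1 1 - hessian (n := 2) f p 0 1 ^ 2)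
    (hs : hessian (n := 2) f p 0 1 = hessian (n := 2) f p 1 0) :
    IsLocalMin f p := by
  have hsm := contDiffAt_comp_chart_symm hf p
  set a := hessian (n := 2) f p 0 0 with ha
  set b := hessian (n := 2) f p 0 1 with hb
  set d := hessian (n := 2) f p 1 1 with hdd
  have hd0 : 0 < d := by
    by_contra h
    nlinarith [sq_nonneg b]
  refine isLocalMin_of_chart (n := 2) (isLocalMin_of_hasFDerivAt_fderiv
    -- Determinant over trace is below the smaller eigenvalue. By Cayley–Hamilton, trace times `⟨Hv,
    -- v⟩` minus determinant times `‖v‖ ^ 2` equals `‖Hv‖ ^ 2`, the sum of the two squares used at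
    -- the end.
    (c := (a * d - b ^ 2) / (a + d)) (by positivity)
    (((hsm.of_le (m := 1) (by simp)).eventually (by simp)).mono fun z hz => hz.differentiableAt (by simp))
    (fderiv_chart_eq_zero hf hp)
    ((hsm.fderiv_right (m := ∞) (by simp)).differentiableAt (by simp)).hasFDerivAt ?_)
  intro v
  have h1 := bilin_fin_two (fderiv ℝ (fderiv ℝ (f ∘ (extChartAt (𝓡 2) p).symm))
    (extChartAt (𝓡 2) p p)) v v
  change _ = v 0 * v 0 * a + v 0 * v 1 * b + v 1 * v 0 * hessian (n := 2) f p 1 0 +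
    v 1 * v 1 * d at h1
  rw [h1, ← hs, EuclideanSpace.norm_sq_eq, Fin.sum_univ_two, Real.norm_eq_abs, Real.norm_eq_abs,
    sq_abs, sq_abs, div_mul_eq_mul_div, div_le_iff₀ (by linarith)]
  nlinarith [sq_nonneg (a * v 0 + b * v 1), sq_nonneg (b * v 0 + d * v 1)]

/-- A positive determinant would make the Hessian definite, and the point a local extremum. -/
theorem IsSaddle.det_hessian_neg {f : M → ℝ} (hf : IsMorse 2 f) {p : M} (hp : IsSaddle 2 f p) :
    (hessian (n := 2) f p).det < 0 := by
  have hs : hessian (n := 2) f p 0 1 = hessian (n := 2) f p 1 0 := hessian_symm hf.smooth p _ _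
  by_contra hcon
  have hpos : 0 < (hessian (n := 2) f p).det :=
    lt_of_le_of_ne (not_lt.1 hcon) (hf.nondegenerate p hp.1).symm
  rw [Matrix.det_fin_two, ← hs, ← sq] at hpos
  rcases lt_trichotomy (hessian (n := 2) f p 0 0) 0 with h | h | h
  · refine hp.2 (isLocalExtr_neg.1 (Or.inl (isLocalMin_of_hessian_pos hf.neg.smooth
      (isCriticalPoint_neg.2 hp.1) ?_ ?_ ?_)))
    · rw [hessian_neg]; simpa using h
    · rw [hessian_neg]; simpa using hpos
    · rw [hessian_neg]; simpa using hs
  · rw [h] at hpos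
    nlinarith [sq_nonneg (hessian (n := 2) f p 0 1)]
  · exact hp.2 (Or.inl (isLocalMin_of_hessian_pos hf.smooth hp.1 h hpos hs))

/-- From `G A = -Hess` in dimension two, `det A * det G = det Hess`; as `det G > 0`, the determinant
of `A` is negative. -/
theorem IsSaddle.nonempty_saddleFrame (g : Metric 2 M) {f : M → ℝ} (hf : IsMorse 2 f) {p : M}
    (hp : IsSaddle 2 f p) : Nonempty (SaddleFrame (linearization g f p)) := by
  refine GradientFlow.nonempty_saddleFrame ?_
  have hdet := hp.det_hessian_neg hf
  rw [Matrix.det_fin_two] at hdet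
  set G := chartMetric g p (extChartAt (𝓡 2) p p) with hG
  set A := linearization g f p
  set e₀ : EuclideanSpace ℝ (Fin 2) := EuclideanSpace.single 0 1 with he₀
  set e₁ : EuclideanSpace ℝ (Fin 2) := EuclideanSpace.single 1 1 with he₁
  have hpos : ∀ v : EuclideanSpace ℝ (Fin 2), v ≠ 0 → 0 < G v v := fun v hv =>
    chartMetric_pos g (mem_extChartAt_target p) hv
  have hsym : G e₀ e₁ = G e₁ e₀ := chartMetric_symm g p _ _ _
  have h00 : 0 < G e₀ e₀ := hpos _ (by simp [he₀])
  have hGd : 0 < G e₀ e₀ * G e₁ e₁ - G e₀ e₁ * G e₁ e₀ := by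
    -- On this vector the form equals `G e₀ e₀` times the determinant of `G`.
    have h1 := hpos (!₂[-G e₀ e₁, G e₀ e₀]) (fun h => by
      have := congrArg (fun v : EuclideanSpace ℝ (Fin 2) => v 1) h
      simp at this
      exact h00.ne' this)
    rw [bilin_fin_two] at h1
    simp only [← he₀, ← he₁, ← hsym] at h1
    simp at h1
    rw [← hsym]
    by_contra hc
    nlinarith
  have key : ∀ i j : Fin 2, A (EuclideanSpace.single i 1) 0 * G e₀ (EuclideanSpace.single j 1) +
      A (EuclideanSpace.single i 1) 1 * G e₁ (EuclideanSpace.single j 1) =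
      -hessian (n := 2) f p i j := by
    intro i j
    have h1 := DFunLike.congr_fun (chartMetric_linearization g hf.smooth hp.1
      (EuclideanSpace.single i 1)) (EuclideanSpace.single j 1)
    have h2 : A (EuclideanSpace.single i 1) = A (EuclideanSpace.single i 1) 0 • e₀ +
        A (EuclideanSpace.single i 1) 1 • e₁ := by
      ext k
      fin_cases k <;> simp [he₀, he₁]
    change G (A (EuclideanSpace.single i 1)) (EuclideanSpace.single j 1) = _ at h1
    rw [h2] at h1
    simp only [map_add, map_smul, add_apply, smul_apply, smul_eq_mul] at h1
    exact h1
  have k00 := key 0 0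
  have k01 := key 0 1
  have k10 := key 1 0
  have k11 := key 1 1
  simp only [← he₀, ← he₁] at k00 k01 k10 k11
  have hprod : (A e₀ 0 * A e₁ 1 - A e₁ 0 * A e₀ 1) * (G e₀ e₀ * G e₁ e₁ - G e₀ e₁ * G e₁ e₀) =
      hessian (n := 2) f p 0 0 * hessian (n := 2) f p 1 1 -
        hessian (n := 2) f p 0 1 * hessian (n := 2) f p 1 0 := by
    have e1 : hessian (n := 2) f p 0 0 = -(A e₀ 0 * G e₀ e₀ + A e₀ 1 * G e₁ e₀) := by linarith
    have e2 : hessian (n := 2) f p 0 1 = -(A e₀ 0 * G e₀ e₁ + A e₀ 1 * G e₁ e₁) := by linarith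
    have e3 : hessian (n := 2) f p 1 0 = -(A e₁ 0 * G e₀ e₀ + A e₁ 1 * G e₁ e₀) := by linarith
    have e4 : hessian (n := 2) f p 1 1 = -(A e₁ 0 * G e₀ e₁ + A e₁ 1 * G e₁ e₁) := by linarith
    rw [e1, e2, e3, e4]
    ring
  by_contra hc
  have := mul_nonneg (not_lt.1 hc) hGd.le
  rw [hprod] at this
  linarith

end SaddlePoints

/-! ### The stable set of a saddle is at most one-dimensional. -/

section StableOrbits

open Asymptotics

namespace SaddleFrame

variable {E : Type*} [NormedAddCommGroup E] [NormedSpace ℝ E] {A : E →L[ℝ] E}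

/-- Differences of the vector field `X` on `U` are `η`-close to those of the linear map `A`. -/
def IsCloseOn (S : SaddleFrame A) (X : E → E) (η : ℝ) (U : Set E) : Prop :=
  ∀ z ∈ U, ∀ w ∈ U,
    |S.s (X z - X w) + S.lam * S.s (z - w)| ≤ η * (|S.s (z - w)| + |S.u (z - w)|) ∧
    |S.u (X z - X w) - S.mu * S.u (z - w)| ≤ η * (|S.s (z - w)| + |S.u (z - w)|)

/-- Two orbits that stay in a bounded set cannot differ mainly in the expanding direction. -/
theorem IsCloseOn.eq_of_forall_mem {S : SaddleFrame A} {X : E → E} {η : ℝ} {U : Set E}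
    (h : S.IsCloseOn X η U) (hη : 0 < η) (hlam : 4 * η ≤ S.lam) (hmu : 4 * η ≤ S.mu)
    (hU : Bornology.IsBounded U) {z w : ℝ → E}
    (hz : ∀ t, 0 ≤ t → HasDerivAt z (X (z t)) t) (hw : ∀ t, 0 ≤ t → HasDerivAt w (X (w t)) t)
    (hzU : ∀ t, 0 ≤ t → z t ∈ U) (hwU : ∀ t, 0 ≤ t → w t ∈ U)
    (h0 : |S.s (z 0 - w 0)| ≤ |S.u (z 0 - w 0)|) : z 0 = w 0 := by
  set a : ℝ → ℝ := fun t => S.s (z t - w t) with ha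
  set b : ℝ → ℝ := fun t => S.u (z t - w t) with hb
  -- The separation is measured by expanding minus contracting square. Hyperbolicity contributes at
  -- least `8 * η * (a² + b²)` to `Q'`, and the error costs at most half of that.
  set Q : ℝ → ℝ := fun t => b t * b t - a t * a t with hQ
  obtain ⟨Q', hQ', hQlow⟩ : ∃ Q' : ℝ → ℝ, (∀ t, 0 ≤ t → HasDerivAt Q (Q' t) t) ∧
      ∀ t, 0 ≤ t → 4 * η * (a t * a t + b t * b t) ≤ Q' t := by
    refine ⟨fun t => (S.u (X (z t) - X (w t)) * b t + b t * S.u (X (z t) - X (w t))) -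
      (S.s (X (z t) - X (w t)) * a t + a t * S.s (X (z t) - X (w t))), fun t ht => ?_,
      fun t ht => ?_⟩
    · have hd := (hz t ht).sub (hw t ht)
      have hda : HasDerivAt a (S.s (X (z t) - X (w t))) t := S.s.hasFDerivAt.comp_hasDerivAt t hd
      have hdb : HasDerivAt b (S.u (X (z t) - X (w t))) t := S.u.hasFDerivAt.comp_hasDerivAt t hd
      exact (hdb.mul hdb).sub (hda.mul hda)
    · obtain ⟨h1, h2⟩ := h _ (hzU t ht) _ (hwU t ht)
      change |S.s (X (z t) - X (w t)) + S.lam * a t| ≤ η * (|a t| + |b t|) at h1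
      change |S.u (X (z t) - X (w t)) - S.mu * b t| ≤ η * (|a t| + |b t|) at h2
      set p := S.s (X (z t) - X (w t))
      set q := S.u (X (z t) - X (w t))
      have h3 : (p + S.lam * a t) * a t ≤ η * (|a t| + |b t|) * |a t| := by
        refine (le_abs_self _).trans ?_
        rw [abs_mul]
        gcongr
      have h4 : -((q - S.mu * b t) * b t) ≤ η * (|a t| + |b t|) * |b t| := by
        refine (neg_le_abs _).trans ?_
        rw [abs_mul]
        gcongr
      have h5 := abs_mul_abs_self (a t)
      have h6 := abs_mul_abs_self (b t)
      have h7 := mul_le_mul_of_nonneg_right hlam (mul_self_nonneg (a t))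
      have h8 := mul_le_mul_of_nonneg_right hmu (mul_self_nonneg (b t))
      have h9 := mul_nonneg hη.le (mul_self_nonneg (|a t| - |b t|))
      simp only
      nlinarith
  have hQ'0 : ∀ t, 0 ≤ t → 0 ≤ Q' t := fun t ht =>
    (by have := mul_self_nonneg (a t); have := mul_self_nonneg (b t); positivity :
      (0 : ℝ) ≤ 4 * η * (a t * a t + b t * b t)).trans (hQlow t ht)
  have hmono : MonotoneOn Q (Ici 0) := by
    refine monotoneOn_of_deriv_nonneg (convex_Ici 0)
      (fun t ht => (hQ' t ht).continuousAt.continuousWithinAt)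
      (fun t ht => (hQ' t (interior_subset ht)).differentiableAt.differentiableWithinAt) ?_
    intro t ht
    rw [(hQ' t (interior_subset ht)).deriv]
    exact hQ'0 t (interior_subset ht)
  have hQ0 : ∀ t, 0 ≤ t → 0 ≤ Q t := fun t ht =>
    (by have := abs_le_iff_mul_self_le.1 h0; simp only [hQ]; linarith : 0 ≤ Q 0).trans
      (hmono (mem_Ici.2 le_rfl) ht ht)
  obtain ⟨B, hB⟩ : ∃ B, ∀ t, 0 ≤ t → Q t ≤ B := by
    obtain ⟨R, hR⟩ := hU.exists_norm_le
    refine ⟨(‖S.u‖ * (R + R)) * (‖S.u‖ * (R + R)), fun t ht => ?_⟩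
    have h1 : |b t| ≤ ‖S.u‖ * (R + R) := (S.u.le_opNorm _).trans (by
      gcongr
      exact (norm_sub_le _ _).trans (add_le_add (hR _ (hzU t ht)) (hR _ (hwU t ht))))
    have h2 := mul_le_mul h1 h1 (abs_nonneg _) ((abs_nonneg _).trans h1)
    rw [abs_mul_abs_self] at h2
    simp only [hQ]
    linarith [mul_self_nonneg (a t)]
  -- Once positive, `Q` grows at least linearly, against its bound. So `Q` is identically zero, and
  -- `Q' 0 = 0` forces both coordinates to vanish.
  have hzero : ∀ t, 0 ≤ t → Q t = 0 := by
    intro t ht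
    refine le_antisymm (not_lt.1 fun hpos => ?_) (hQ0 t ht)
    have hgrow : ∀ s, t ≤ s → 4 * η * Q t * (s - t) ≤ Q s - Q t := by
      intro s hs
      refine (convex_Ici t).mul_sub_le_image_sub_of_le_deriv
        (fun r hr => (hQ' r (ht.trans hr)).continuousAt.continuousWithinAt)
        (fun r hr => (hQ' r (ht.trans (interior_subset hr))).differentiableAt.differentiableWithinAt)
        ?_ t (mem_Ici.2 le_rfl) s hs hs
      intro r hr
      have hr' : t ≤ r := interior_subset hr
      rw [(hQ' r (ht.trans hr')).deriv]
      refine le_trans ?_ (hQlow r (ht.trans hr'))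
      have h1 := hmono ht (mem_Ici.2 (ht.trans hr')) hr'
      have h2 : Q r ≤ a r * a r + b r * b r := by
        simp only [hQ]
        linarith [mul_self_nonneg (a r)]
      gcongr
      exact h1.trans h2
    have h1 := hgrow (t + (B + 1) / (4 * η * Q t)) (le_add_of_nonneg_right
      (div_nonneg (by linarith [hB t ht]) (by positivity)))
    rw [add_sub_cancel_left, mul_div_cancel₀ _ (by positivity)] at h1
    linarith [hB (t + (B + 1) / (4 * η * Q t)) (add_nonneg ht
      (div_nonneg (by linarith [hB t ht]) (by positivity)))]
  have h1 : Q' 0 = 0 := by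
    refine (uniqueDiffWithinAt_Ici (0 : ℝ)).eq_deriv _ (hQ' 0 le_rfl).hasDerivWithinAt ?_
    exact (hasDerivWithinAt_const (0 : ℝ) (Ici 0) (0 : ℝ)).congr (fun t ht => hzero t ht)
      (hzero 0 le_rfl)
  have h2 := hQlow 0 le_rfl
  rw [h1] at h2
  have h3 : a 0 * a 0 + b 0 * b 0 ≤ 0 := nonpos_of_mul_nonpos_right h2 (by positivity)
  have ha0 : a 0 = 0 := mul_self_eq_zero.1
    (le_antisymm (by linarith [mul_self_nonneg (b 0)]) (mul_self_nonneg _))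
  have hb0 : b 0 = 0 := mul_self_eq_zero.1
    (le_antisymm (by linarith [mul_self_nonneg (a 0)]) (mul_self_nonneg _))
  exact sub_eq_zero.1 (S.eq_of_coords (by rw [map_zero]; exact ha0) (by rw [map_zero]; exact hb0))

end SaddleFrame

/-- Used to synchronize two orbits on the same side of a saddle: on its way to zero the farther one
passes through the starting value of the nearer one. -/
theorem exists_nonneg_eq_of_tendsto_zero {a b : ℝ → ℝ} (ha : ContinuousOn a (Ici 0))
    (hb : ContinuousOn b (Ici 0)) (ha0 : Tendsto a atTop (𝓝 0)) (hb0 : Tendsto b atTop (𝓝 0))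
    (h : 0 < a 0 * b 0) : ∃ s t, 0 ≤ s ∧ 0 ≤ t ∧ a s = b t := by
  have key : ∀ a b : ℝ → ℝ, ContinuousOn b (Ici 0) → Tendsto b atTop (𝓝 0) → 0 < a 0 →
      a 0 ≤ b 0 → ∃ t, 0 ≤ t ∧ a 0 = b t := by
    intro a b hb hb0 h1 h2
    obtain ⟨T, hT, hT0⟩ := ((hb0.eventually (gt_mem_nhds h1)).and (eventually_ge_atTop 0)).exists
    obtain ⟨t, ht, hte⟩ := intermediate_value_Icc' hT0 (hb.mono Icc_subset_Ici_self)
      ⟨hT.le, h2⟩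
    exact ⟨t, ht.1, hte.symm⟩
  have key2 : ∀ a b : ℝ → ℝ, ContinuousOn a (Ici 0) → ContinuousOn b (Ici 0) →
      Tendsto a atTop (𝓝 0) → Tendsto b atTop (𝓝 0) → 0 < a 0 → 0 < b 0 →
      ∃ s t, 0 ≤ s ∧ 0 ≤ t ∧ a s = b t := by
    intro a b ha hb ha0 hb0 h1 h2
    rcases le_total (a 0) (b 0) with h3 | h3
    · obtain ⟨t, ht, h4⟩ := key a b hb hb0 h1 h3
      exact ⟨0, t, le_rfl, ht, h4⟩
    · obtain ⟨t, ht, h4⟩ := key b a ha ha0 h2 h3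
      exact ⟨t, 0, ht, le_rfl, h4.symm⟩
  rcases mul_pos_iff.1 h with ⟨h1, h2⟩ | ⟨h1, h2⟩
  · exact key2 a b ha hb ha0 hb0 h1 h2
  · obtain ⟨s, t, hs, ht, h3⟩ := key2 (fun t => -a t) (fun t => -b t) ha.neg hb.neg
      (by simpa using ha0.neg) (by simpa using hb0.neg) (by simpa using h1) (by simpa using h2)
    exact ⟨s, t, hs, ht, neg_injective h3⟩

namespace IsGradFlow

variable {n : ℕ} {M : Type*} [TopologicalSpace M] [ChartedSpace (EuclideanSpace ℝ (Fin n)) M]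
  [IsManifold (𝓡 n) ∞ M] {g : Metric n M} {f : M → ℝ} {φ : ℝ → M → M} (hφ : IsGradFlow g f φ)

include hφ

theorem hasDerivAt_chart {x y : M} {t : ℝ} (h : φ t y ∈ (extChartAt (𝓡 n) x).source) :
    HasDerivAt (fun t => extChartAt (𝓡 n) x (φ t y))
      (chartField g f x (extChartAt (𝓡 n) x (φ t y))) t := by
  have : IsManifold (𝓡 n) 1 M := IsManifold.of_le (n := ∞) (by simp)
  unfold chartField
  rw [chartRep_extChartAt _ h]
  exact hasDerivAt_chart_of_hasMFDerivAt (hφ.line y t) h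

/-- Near a regular point of the stable manifold of a saddle point, the stable manifold consists of
a single orbit. -/
theorem eventually_mem_orbit [T2Space M] [CompactSpace M] (hf : IsMorse n f) {p : M}
    (hp : IsCriticalPoint (n := n) f p) (S : SaddleFrame (linearization g f p)) {x : M}
    (hx : x ∈ stable g f p) (hxc : ¬ IsCriticalPoint (n := n) f x) :
    ∀ᶠ y in 𝓝 x, y ∈ stable g f p → ∃ τ, y = φ τ x := by
  set e := extChartAt (𝓡 n) p with he
  set η := min S.lam S.mu / 4 with hη
  have hη0 : 0 < η := by have := lt_min S.lam_pos S.mu_pos; positivity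
  obtain ⟨r, hr, hclose⟩ := S.eventually_coords (hasStrictFDerivAt_chartField g hf.smooth p) hη0
  have hclose' : S.IsCloseOn (chartField g f p) η (Metric.ball (e p) r) := hclose
  have heq : ∀ z w : ℝ → EuclideanSpace ℝ (Fin n), _ → _ → _ → _ → _ → _ := fun z w hz hw hzU hwU =>
    hclose'.eq_of_forall_mem (z := z) (w := w) hη0 (by linarith [min_le_left S.lam S.mu])
      (by linarith [min_le_right S.lam S.mu]) Metric.isBounded_ball hz hw hzU hwU
  have hN : {y | y ∈ e.source ∧ e y ∈ Metric.ball (e p) r ∧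
      (y ≠ p → ¬ IsCriticalPoint (n := n) f y)} ∈ 𝓝 p := by
    filter_upwards [extChartAt_source_mem_nhds (I := 𝓡 n) p,
      (continuousAt_extChartAt (I := 𝓡 n) p).preimage_mem_nhds (Metric.ball_mem_nhds _ hr),
      eventually_nhdsWithin_iff.1 (eventually_not_isCriticalPoint hf hp)] with y h1 h2 h3
    exact ⟨h1, h2, h3⟩
  obtain ⟨W, hW, hWc, hWN⟩ := exists_mem_nhds_isClosed_subset hN
  obtain ⟨δ, hδ, hstay⟩ := hφ.exists_forall_mem_of_lt hf.smooth hW (by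
    intro z hz
    refine (hWN (hWc.frontier_subset hz)).2.2 ?_
    rintro rfl
    exact hz.2 (mem_interior_iff_mem_nhds.2 hW))
  have hlim := (hf.smooth.continuous.tendsto p).comp (hφ.mem_stable_iff.1 hx)
  obtain ⟨T, hT⟩ := (hlim.eventually (gt_mem_nhds (lt_add_of_pos_right (f p) hδ))).exists
  have hode : ∀ y, (∀ t, 0 ≤ t → φ t y ∈ W) → ∀ t, 0 ≤ t → HasDerivAt (fun t => e (φ t y))
      (chartField g f p (e (φ t y))) t := fun y hy t ht => hφ.hasDerivAt_chart (hWN (hy t ht)).1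
  have hin : ∀ y, (∀ t, 0 ≤ t → φ t y ∈ W) → ∀ t, 0 ≤ t → e (φ t y) ∈ Metric.ball (e p) r :=
    fun y hy t ht => (hWN (hy t ht)).2.1
  have hinj : ∀ y ∈ W, ∀ z ∈ W, e y = e z → y = z := fun y hy z hz h =>
    e.injOn (hWN hy).1 (hWN hz).1 h
  have hpW : ∀ t, 0 ≤ t → φ t p ∈ W := fun t _ => by
    rw [hφ.apply_of_isCriticalPoint hp]
    exact mem_of_mem_nhds hW
  have hstart : ∀ y, (∀ t, 0 ≤ t → φ t y ∈ W) → y ∈ W := fun y hy => by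
    simpa only [hφ.zero] using hy 0 le_rfl
  have hxW := hstay _ ((hφ.apply_mem_stable_iff T).2 hx) hT
  -- Otherwise the orbit of `φ T x` and the constant orbit `p` differ only in the expanding
  -- direction and would coincide.
  have hsx : S.s (e (φ T x) - e p) ≠ 0 := by
    intro h0
    have h1 := heq _ _ (hode _ hxW) (hode _ hpW) (hin _ hxW) (hin _ hpW) (by
      simp only [hφ.zero]
      rw [h0, abs_zero]
      exact abs_nonneg _)
    simp only [hφ.zero] at h1
    have h2 := hinj _ (hstart _ hxW) _ (mem_of_mem_nhds hW) h1
    exact hxc (hφ.isCriticalPoint_of_apply (t := T) (by rwa [h2]))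
  have hcont : ContinuousAt (fun y => S.s (e (φ T x) - e p) * S.s (e (φ T y) - e p)) x := by
    have h1 : ContinuousAt (fun y => e (φ T y)) x :=
      ContinuousAt.comp (f := φ T)
        (continuousAt_extChartAt' (I := 𝓡 n) (hWN (hstart _ hxW)).1)
        (hφ.continuous_space T).continuousAt
    exact continuousAt_const.mul (S.s.continuous.continuousAt.comp (h1.sub continuousAt_const))
  filter_upwards [hcont.eventually (lt_mem_nhds (mul_self_pos.2 hsx)),
    (hf.smooth.continuous.comp (hφ.continuous_space T)).continuousAt.eventually
      (gt_mem_nhds hT)] with y hsy hTy hy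
  have hyW := hstay _ ((hφ.apply_mem_stable_iff T).2 hy) hTy
  have hcoord : ∀ w ∈ stable g f p, (∀ t, 0 ≤ t → φ t w ∈ W) →
      ContinuousOn (fun t => S.s (e (φ t w) - e p)) (Ici 0) ∧
      Tendsto (fun t => S.s (e (φ t w) - e p)) atTop (𝓝 0) := by
    intro w hw hwW
    refine ⟨fun t ht => ?_, ?_⟩
    · exact (S.s.continuous.continuousAt.comp
        ((hode w hwW t ht).continuousAt.sub continuousAt_const)).continuousWithinAt
    · have h1 := ((continuousAt_extChartAt (I := 𝓡 n) p).tendsto.comp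
        (hφ.mem_stable_iff.1 hw)).sub_const (e p)
      have h2 := (S.s.continuous.tendsto _).comp h1
      rwa [sub_self, map_zero] at h2
  obtain ⟨hc1, ht1⟩ := hcoord _ ((hφ.apply_mem_stable_iff T).2 hx) hxW
  obtain ⟨hc2, ht2⟩ := hcoord _ ((hφ.apply_mem_stable_iff T).2 hy) hyW
  -- For `y` near `x` the contracting coordinates have the same sign, so they agree at suitable
  -- times. There the two points differ only in the expanding direction, hence are equal.
  obtain ⟨a, b, ha, hb, hab⟩ := exists_nonneg_eq_of_tendsto_zero hc1 hc2 ht1 ht2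
    (by simpa only [hφ.zero] using hsy)
  have hshift : ∀ w a, 0 ≤ a → (∀ t, 0 ≤ t → φ t w ∈ W) → ∀ t, 0 ≤ t → φ t (φ a w) ∈ W :=
    fun w a ha hw t ht => by
      rw [← hφ.add]
      exact hw _ (add_nonneg ht ha)
  have hxa := hshift _ a ha hxW
  have hyb := hshift _ b hb hyW
  have h1 := heq _ _ (hode _ hxa) (hode _ hyb) (hin _ hxa) (hin _ hyb) (by
    have h2 : S.s (e (φ a (φ T x)) - e (φ b (φ T y))) = 0 := by
      rw [map_sub] at hab ⊢
      rw [map_sub] at hab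
      linarith
    simp only [hφ.zero]
    rw [h2, abs_zero]
    exact abs_nonneg _)
  simp only [hφ.zero] at h1
  have h2 := hinj _ (hstart _ hxa) _ (hstart _ hyb) h1
  refine ⟨-(b + T) + (a + T), ?_⟩
  rw [hφ.add, hφ.add a, h2, ← hφ.add b, hφ.neg_apply_self]

theorem hasDerivAt_chart_self (x : M) :
    HasDerivAt (fun t => extChartAt (𝓡 n) x (φ t x)) (-grad g f x) 0 := by
  have h1 := hφ.hasDerivAt_chart (x := x) (y := x) (t := 0)
    (by rw [hφ.zero]; exact mem_extChartAt_source x)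
  refine h1.congr_deriv ?_
  rw [hφ.zero]
  exact (chartRep_extChartAt _ (mem_extChartAt_source x)).trans
    (tangentCoordChange_self (mem_extChartAt_source x))

/-- The stable manifold of a saddle point is at most one-dimensional at regular points. -/
theorem tangentOf_stable_le [T2Space M] [CompactSpace M] (hf : IsMorse n f) {p : M}
    (hp : IsCriticalPoint (n := n) f p) (S : SaddleFrame (linearization g f p)) {x : M}
    (hx : x ∈ stable g f p) (hxc : ¬ IsCriticalPoint (n := n) f x) :
    tangentOf (stable g f p) x ≤ Submodule.span ℝ {grad g f x} := by
  refine Submodule.span_le.2 ?_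
  rintro v ⟨γ, hγ0, hγS, hγd⟩
  subst hγ0
  by_contra hv
  obtain ⟨ℓ, hℓv, hℓ⟩ := Submodule.exists_le_ker_of_notMem hv
  have hℓg : ℓ (grad g f (γ 0)) = 0 := hℓ (Submodule.mem_span_singleton_self _)
  set e := extChartAt (𝓡 n) (γ 0)
  let L : EuclideanSpace ℝ (Fin n) →L[ℝ] ℝ :=
    LinearMap.toContinuousLinearMap (E := EuclideanSpace ℝ (Fin n)) ℓ
  let w : EuclideanSpace ℝ (Fin n) := -grad g f (γ 0)
  have hLw : L w = 0 := (map_neg ℓ _).trans (by rw [hℓg, neg_zero])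
  have hw : w ≠ 0 := fun h => hxc ((grad_eq_zero_iff g f (γ 0)).1 (neg_eq_zero.1 h))
  obtain ⟨hγc, hγd⟩ := hasMFDerivAt_curve_iff.1 hγd
  have hF : HasDerivAt (fun t => e (φ t (γ 0))) w 0 := hφ.hasDerivAt_chart_self (γ 0)
  -- A curve in the stable set is a reparametrized orbit `φ (τ t) (γ 0)` near `t = 0`; the value of
  -- `τ` elsewhere is irrelevant.
  have hτex : ∀ t, ∃ τ, (∃ σ, γ t = φ σ (γ 0)) → γ t = φ τ (γ 0) := fun t => by
    by_cases h : ∃ σ, γ t = φ σ (γ 0)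
    · exact ⟨h.choose, fun _ => h.choose_spec⟩
    · exact ⟨0, fun h' => absurd h' h⟩
  choose τ hτ using hτex
  have hγτ : ∀ᶠ t in 𝓝 0, γ t = φ (τ t) (γ 0) := by
    filter_upwards [hγc.eventually (hφ.eventually_mem_orbit hf hp S hx hxc), hγS] with t h1 h2
    exact hτ t (h1 h2)
  have hanti := hφ.strictAnti hf.smooth hxc
  have hτ0 : Tendsto τ (𝓝 0) (𝓝 0) := by
    have hfγ : ContinuousAt (fun t => f (γ t)) 0 := hf.smooth.continuous.continuousAt.comp hγc
    rw [tendsto_order]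
    constructor
    · intro a ha
      have h1 := hanti ha
      simp only [hφ.zero] at h1
      filter_upwards [hγτ, hfγ.eventually (gt_mem_nhds h1)] with t h2 h3
      rw [h2] at h3
      exact hanti.lt_iff_gt.1 h3
    · intro a ha
      have h1 := hanti ha
      simp only [hφ.zero] at h1
      filter_upwards [hγτ, hfγ.eventually (lt_mem_nhds h1)] with t h2 h3
      rw [h2] at h3
      exact hanti.lt_iff_gt.1 h3
  -- The orbit has nonzero velocity, so its displacement is comparable to `τ t`; for the
  -- differentiable `γ` that displacement is `O(t)`.
  have hbig : τ =O[𝓝 0] fun t : ℝ => t := by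
    have h1 := (hF.isTheta_sub hw).isBigO_symm.comp_tendsto
      (hτ0.prodMk (tendsto_pure.2 (Eventually.of_forall fun _ => rfl)))
    have h2 := hγd.isBigO_sub
    refine IsBigO.trans (h1.congr' (Eventually.of_forall fun t => sub_zero _) ?_)
      (h2.congr_right fun t => sub_zero _)
    filter_upwards [hγτ] with t ht
    simp only [Function.comp_apply]
    rw [hφ.zero, ht]
  -- A functional killing the gradient varies by `o(τ t)`, hence by `o(t)`, along `γ`; so it kills
  -- the velocity of `γ` too.
  have hsmall : HasDerivAt (fun t => L (e (γ t))) 0 0 := by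
    rw [hasDerivAt_iff_isLittleO]
    have h1 : HasDerivAt (fun t => L (e (φ t (γ 0)))) (L w) 0 := L.hasFDerivAt.comp_hasDerivAt 0 hF
    rw [hLw, hasDerivAt_iff_isLittleO] at h1
    refine ((h1.comp_tendsto hτ0).congr' ?_ (Eventually.of_forall fun t => sub_zero _)).trans_isBigO
      (hbig.congr_right fun t => (sub_zero _).symm)
    filter_upwards [hγτ] with t ht
    simp only [Function.comp_apply, smul_zero]
    rw [hφ.zero, ht]
  have hLv : HasDerivAt (fun t => L (e (γ t))) (L v) 0 := L.hasFDerivAt.comp_hasDerivAt 0 hγd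
  exact hℓv (hLv.unique hsmall)

end IsGradFlow

end StableOrbits

/-! ### The contracting direction is tangent to the stable set. -/

section StableTangent

namespace IsGradFlow

variable {n : ℕ} {M : Type*} [TopologicalSpace M] [ChartedSpace (EuclideanSpace ℝ (Fin n)) M]
  [IsManifold (𝓡 n) ∞ M] {g : Metric n M} {f : M → ℝ} {φ : ℝ → M → M} (hφ : IsGradFlow g f φ)

include hφ

theorem isOpen_setOf_exists_apply_mem {V D : Set M} (hV : IsOpen V) (hD : IsOpen D) :
    IsOpen {y | ∃ T, 0 ≤ T ∧ (∀ t ∈ Icc 0 T, φ t y ∈ V) ∧ φ T y ∈ D} := by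
  rw [isOpen_iff_mem_nhds]
  rintro y ⟨T, hT, hVy, hDy⟩
  have h1 : ∀ᶠ x in 𝓝 y, ∀ t ∈ Icc 0 T, φ t x ∈ V := by
    refine isCompact_Icc.eventually_forall_of_forall_eventually fun t ht => ?_
    exact (hφ.cont.comp continuous_swap).continuousAt.eventually (hV.mem_nhds (hVy t ht))
  filter_upwards [h1, (hφ.continuous_space T).continuousAt.eventually (hD.mem_nhds hDy)] with x h2 h3
  exact ⟨T, hT, h2, h3⟩

/-- In every thin cone around the contracting direction of a saddle point, the stable manifold
meets each segment across the cone. -/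
theorem exists_mem_stable_cone [T2Space M] [CompactSpace M]
    (hf : ContMDiff (𝓡 n) 𝓘(ℝ, ℝ) ∞ f) {p : M}
    (hp : IsCriticalPoint (n := n) f p) (S : SaddleFrame (linearization g f p)) {ε : ℝ}
    (hε : 0 < ε) (hε1 : ε ≤ 1) : ∃ ρ > 0, ∀ s₀, 0 < s₀ → s₀ < ρ → ∃ u₀, |u₀| ≤ 2 * ε * s₀ ∧
      (extChartAt (𝓡 n) p).symm (extChartAt (𝓡 n) p p + s₀ • S.es + u₀ • S.eu) ∈
        stable g f p := by
  set e := extChartAt (𝓡 n) p with he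
  set X := chartField g f p with hX
  set m := min S.lam S.mu with hm
  have hm0 : 0 < m := lt_min S.lam_pos S.mu_pos
  have hml : m ≤ S.lam := min_le_left _ _
  have hmm : m ≤ S.mu := min_le_right _ _
  set η := ε * m / 8 with hη
  have hη0 : 0 < η := by positivity
  obtain ⟨r₁, hr₁, hclose⟩ := S.eventually_coords (hasStrictFDerivAt_chartField g hf p) hη0
  obtain ⟨r₂, hr₂, htarget⟩ := Metric.mem_nhds_iff.1 (extChartAt_target_mem_nhds (I := 𝓡 n) p)
  obtain ⟨C, hC, hnorm⟩ := S.norm_le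
  set r := min r₁ r₂ with hr
  have hr0 : 0 < r := lt_min hr₁ hr₂
  set a : EuclideanSpace ℝ (Fin n) → ℝ := fun z => S.s (z - e p) with ha
  set b : EuclideanSpace ℝ (Fin n) → ℝ := fun z => S.u (z - e p) with hb
  have hac : Continuous a := S.s.continuous.comp (continuous_id.sub continuous_const)
  have hbc : Continuous b := S.u.continuous.comp (continuous_id.sub continuous_const)
  have hbound : ∀ z ∈ Metric.ball (e p) r,
      |S.s (X z) + S.lam * a z| ≤ η * (|a z| + |b z|) ∧
      |S.u (X z) - S.mu * b z| ≤ η * (|a z| + |b z|) := by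
    intro z hz
    have h1 := hclose z (Metric.ball_subset_ball (min_le_left _ _) hz) (e p)
      (Metric.mem_ball_self hr₁)
    have h2 : chartField g f p (e p) = 0 := chartField_self g hp
    rwa [h2, sub_zero] at h1
  have hbt : Metric.ball (e p) r ⊆ e.target :=
    (Metric.ball_subset_ball (min_le_right _ _)).trans htarget
  -- `V` is a cone of slope `2 * ε`, punctured at its tip. The contracting coordinate decreases in
  -- it, and the orbits sought stay in the cone of slope `ε`.
  set V : Set M := e.source ∩ e ⁻¹' {z | z ∈ Metric.ball (e p) r ∧ 0 < a z ∧ |b z| < 2 * ε * a z}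
    with hV
  have hVo : IsOpen V := isOpen_extChartAt_preimage' (I := 𝓡 n) p (Metric.isOpen_ball.inter
    ((isOpen_lt continuous_const hac).inter (isOpen_lt hbc.abs (continuous_const.mul hac))))
  have hVd : ∀ y ∈ V, S.s (X (e y)) < 0 := by
    rintro y ⟨-, hz, h1, h2⟩
    have h3 := (le_abs_self _).trans (hbound _ hz).1
    rw [abs_of_pos h1] at h3
    have h4 : η * (a (e y) + |b (e y)|) ≤ η * (3 * a (e y)) := by
      gcongr
      nlinarith
    have h5 : η ≤ m / 8 := by rw [hη]; nlinarith
    have h6 : η * a (e y) ≤ m / 8 * a (e y) := by gcongr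
    have h7 : m * a (e y) ≤ S.lam * a (e y) := by gcongr
    have h8 : 0 < m * a (e y) := by positivity
    linarith
  have hVc : ∀ y ∈ V, ¬ IsCriticalPoint (n := n) f y := by
    intro y hy hc
    have h1 : X (e y) = 0 := (chartField_eq_zero_iff g (e.map_source hy.1)).2
      (by rwa [e.left_inv hy.1])
    have h2 := hVd y hy
    rw [h1, map_zero] at h2
    exact lt_irrefl _ h2
  have hda : ∀ y t, φ t y ∈ V → HasDerivAt (fun t => a (e (φ t y))) (S.s (X (e (φ t y)))) t :=
    fun y t h => S.s.hasFDerivAt.comp_hasDerivAt t ((hφ.hasDerivAt_chart h.1).sub_const (e p))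
  have hdb : ∀ y t, φ t y ∈ V → HasDerivAt (fun t => b (e (φ t y))) (S.u (X (e (φ t y)))) t :=
    fun y t h => S.u.hasFDerivAt.comp_hasDerivAt t ((hφ.hasDerivAt_chart h.1).sub_const (e p))
  -- On the boundary of the cone of slope `ε` the field points out of it, so an orbit that has left
  -- on the side `σ` cannot reenter while in `V`.
  have hbarrier : ∀ σ : ℝ, |σ| = 1 → ∀ y T T', T ≤ T' → (∀ t ∈ Icc T T', φ t y ∈ V) →
      ε * a (e (φ T y)) < σ * b (e (φ T y)) → ε * a (e (φ T' y)) ≤ σ * b (e (φ T' y)) := by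
    intro σ hσ y T T' hTT hVy h0
    have hd : ∀ t ∈ Icc T T', HasDerivAt (fun t => ε * a (e (φ t y)) - σ * b (e (φ t y)))
        (ε * S.s (X (e (φ t y))) - σ * S.u (X (e (φ t y)))) t := fun t ht =>
      ((hda y t (hVy t ht)).const_mul ε).sub ((hdb y t (hVy t ht)).const_mul σ)
    have h1 := image_le_of_deriv_right_lt_deriv_boundary' (B := fun _ => (0 : ℝ))
      (B' := fun _ => (0 : ℝ))
      (fun t ht => (hd t ht).continuousAt.continuousWithinAt)
      (fun t ht => (hd t (Ico_subset_Icc_self ht)).hasDerivWithinAt) (by linarith)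
      continuousOn_const (fun t _ => hasDerivWithinAt_const _ _ _) (fun t ht heq => ?_)
      (right_mem_Icc.2 hTT)
    · exact sub_nonpos.1 h1
    · obtain ⟨-, hz, h1, -⟩ := hVy t (Ico_subset_Icc_self ht)
      obtain ⟨h3, h4⟩ := hbound _ hz
      have hbe : |b (e (φ t y))| = ε * a (e (φ t y)) := by
        rw [← one_mul |b _|, ← hσ, ← abs_mul, ← sub_eq_zero.1 heq, abs_of_pos (by positivity)]
      have heq' := sub_eq_zero.1 heq
      rw [hbe, abs_of_pos h1] at h3 h4
      have h5 := (le_abs_self _).trans h3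
      have h6 : -(σ * (S.u (X (e (φ t y))) - S.mu * b (e (φ t y)))) ≤
          η * (a (e (φ t y)) + ε * a (e (φ t y))) := by
        refine (neg_le_abs _).trans ?_
        rwa [abs_mul, hσ, one_mul]
      set α := a (e (φ t y))
      have h7 : ε * S.s (X (e (φ t y))) ≤ ε * (η * (α + ε * α) - S.lam * α) := by
        gcongr
        linarith
      have h8 : η * (α + ε * α) ≤ η * (2 * α) := by gcongr; nlinarith
      have h9 : ε * (η * (α + ε * α)) ≤ 1 * (η * (2 * α)) := by gcongr
      have h10 : ε * (m * α) ≤ ε * (S.lam * α) := by gcongr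
      have h11 : S.mu * (σ * b (e (φ t y))) = S.mu * (ε * α) := by rw [heq']
      have h12 : m * (ε * α) ≤ S.mu * (ε * α) := by gcongr
      have h13 : 0 < m * (ε * α) := by positivity
      have h14 : η * (2 * α) = m * (ε * α) / 4 := by rw [hη]; ring
      linarith
  refine ⟨r / (4 * C), by positivity, fun s₀ hs₀ hs₀r => ?_⟩
  have hCs : 4 * C * s₀ < r := by rwa [lt_div_iff₀ (by positivity), mul_comm] at hs₀r
  have hball : ∀ z, 0 ≤ a z → a z ≤ s₀ → |b z| ≤ 2 * ε * a z → z ∈ Metric.ball (e p) r := by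
    intro z h1 h2 h3
    rw [Metric.mem_ball, dist_eq_norm]
    refine (hnorm (z - e p)).trans_lt (lt_of_le_of_lt ?_ hCs)
    change C * (|a z| + |b z|) ≤ _
    rw [abs_of_nonneg h1, mul_comm 4 C, mul_assoc]
    gcongr
    nlinarith
  set P : ℝ → M := fun u => e.symm (e p + s₀ • S.es + u • S.eu) with hP
  have hPa : ∀ u : ℝ, a (e p + s₀ • S.es + u • S.eu) = s₀ := by
    intro u
    simp only [ha]
    rw [add_assoc, add_sub_cancel_left, map_add, map_smul, map_smul, S.s_es, S.s_eu]
    simp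
  have hPb : ∀ u : ℝ, b (e p + s₀ • S.es + u • S.eu) = u := by
    intro u
    simp only [hb]
    rw [add_assoc, add_sub_cancel_left, map_add, map_smul, map_smul, S.u_es, S.u_eu]
    simp
  -- Slope `3 / 2 * ε` lies between `ε` and `2 * ε`: the whole segment is in `V`, and its ends are
  -- already outside the inner cone, one on each side.
  set I := Icc (-(3 / 2 * ε * s₀)) (3 / 2 * ε * s₀) with hI
  have hIabs : ∀ u ∈ I, |u| < 2 * ε * s₀ := fun u hu =>
    (abs_le.2 hu).trans_lt (by have : 0 < ε * s₀ := by positivity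
                               linarith)
  have hPball : ∀ u ∈ I, e p + s₀ • S.es + u • S.eu ∈ Metric.ball (e p) r := fun u hu =>
    hball _ (by rw [hPa]; exact hs₀.le) (hPa u).le (by rw [hPa, hPb]; exact (hIabs u hu).le)
  have hPe : ∀ u ∈ I, e (P u) = e p + s₀ • S.es + u • S.eu := fun u hu =>
    e.right_inv (hbt (hPball u hu))
  have hPV : ∀ u ∈ I, P u ∈ V := fun u hu => by
    refine ⟨e.map_target (hbt (hPball u hu)), ?_⟩
    rw [mem_preimage, hPe u hu]
    exact ⟨hPball u hu, by rwa [hPa], by rw [hPa, hPb]; exact hIabs u hu⟩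
  have hPc : ContinuousOn P I := by
    refine (continuousOn_extChartAt_symm (I := 𝓡 n) p).comp
      (Continuous.continuousOn (by fun_prop)) fun u hu => hbt (hPball u hu)
  set D : ℝ → Set M := fun σ => e.source ∩ e ⁻¹' {z | ε * a z < σ * b z} with hD
  have hDo : ∀ σ, IsOpen (D σ) := fun σ => isOpen_extChartAt_preimage' (I := 𝓡 n) p
    (isOpen_lt (continuous_const.mul hac) (continuous_const.mul hbc))
  set B : ℝ → Set M := fun σ => {y | ∃ T, 0 ≤ T ∧ (∀ t ∈ Icc 0 T, φ t y ∈ V) ∧ φ T y ∈ D σ}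
    with hB
  have hBo : ∀ σ, IsOpen (B σ) := fun σ => hφ.isOpen_setOf_exists_apply_mem hVo (hDo σ)
  have hdisj : ∀ y, y ∈ B 1 → y ∈ B (-1) → False := by
    have key : ∀ σ : ℝ, |σ| = 1 → ∀ y T T', 0 ≤ T → T ≤ T' → (∀ t ∈ Icc 0 T', φ t y ∈ V) →
        φ T y ∈ D σ → φ T' y ∈ D (-σ) → False := by
      intro σ hσ y T T' hT hTT hVy h1 h2
      have h3 := hbarrier σ hσ y T T' hTT (fun t ht => hVy t ⟨hT.trans ht.1, ht.2⟩) h1.2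
      have h4 : ε * a (e (φ T' y)) < -σ * b (e (φ T' y)) := h2.2
      have h5 : 0 < ε * a (e (φ T' y)) := mul_pos hε (hVy T' ⟨hT.trans hTT, le_rfl⟩).2.2.1
      linarith
    rintro y ⟨T, hT, hTV, hTD⟩ ⟨T', hT', hTV', hTD'⟩
    rcases le_total T T' with h | h
    · exact key 1 (by simp) y T T' hT h hTV' hTD hTD'
    · exact key (-1) (by simp) y T' T hT' h hTV hTD' (by rwa [neg_neg])
  -- The points leaving the inner cone on either side form disjoint open sets, each containing one
  -- end of the segment; by connectedness they do not cover it.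
  obtain ⟨u₀, hu₀, hnot⟩ : ∃ u ∈ I, ∀ σ : ℝ, |σ| = 1 → P u ∉ B σ := by
    by_contra! hcon
    have hmem : ∀ σ : ℝ, |σ| = 1 → (P '' I ∩ B σ).Nonempty := by
      intro σ hσ
      have h1 : σ * (3 / 2 * ε * s₀) ∈ I := by
        rw [hI, mem_Icc, ← abs_le, abs_mul, hσ, one_mul, abs_of_pos (by positivity)]
      refine ⟨_, mem_image_of_mem P h1, 0, le_rfl, ?_, ?_⟩
      · intro t ht
        rw [Icc_self] at ht
        rw [mem_singleton_iff.1 ht, hφ.zero]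
        exact hPV _ h1
      · rw [hφ.zero]
        refine ⟨(hPV _ h1).1, ?_⟩
        rw [mem_preimage, hPe _ h1, mem_ofPred_eq, hPa, hPb, ← mul_assoc, ← abs_mul_abs_self σ, hσ]
        have : 0 < ε * s₀ := by positivity
        linarith
    obtain ⟨y, -, h1, h2⟩ := (isPreconnected_Icc.image P hPc) (B 1) (B (-1)) (hBo 1) (hBo (-1))
      (by
        rintro _ ⟨u, hu, rfl⟩
        obtain ⟨σ, hσ, h⟩ := hcon u hu
        rcases eq_or_eq_neg_of_abs_eq hσ with rfl | rfl
        · exact Or.inl h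
        · exact Or.inr h) (hmem 1 (by simp)) (hmem (-1) (by simp))
    exact hdisj y h1 h2
  refine ⟨u₀, (hIabs u₀ hu₀).le, ?_⟩
  change P u₀ ∈ stable g f p
  set K : Set M := e.symm '' {z | 0 ≤ a z ∧ a z ≤ s₀ ∧ |b z| ≤ ε * a z} with hK
  have hKb : ∀ z, 0 ≤ a z ∧ a z ≤ s₀ ∧ |b z| ≤ ε * a z → z ∈ Metric.ball (e p) r := fun z hz =>
    hball z hz.1 hz.2.1 (hz.2.2.trans (by nlinarith [mul_nonneg hε.le hz.1]))
  have hKc : IsClosed K := by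
    have h1 : IsClosed {z | 0 ≤ a z ∧ a z ≤ s₀ ∧ |b z| ≤ ε * a z} :=
      (isClosed_le continuous_const hac).inter ((isClosed_le hac continuous_const).inter
        (isClosed_le hbc.abs (continuous_const.mul hac)))
    exact ((Metric.isCompact_of_isClosed_isBounded h1 (Metric.isBounded_ball.subset hKb)).image_of_continuousOn
      ((continuousOn_extChartAt_symm (I := 𝓡 n) p).mono fun z hz => hbt (hKb z hz))).isClosed
  have hKV : ∀ y ∈ K, y ≠ p → y ∈ V := by
    rintro _ ⟨z, hz, rfl⟩ hne
    have hzt := hbt (hKb z hz)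
    refine ⟨e.map_target hzt, ?_⟩
    rw [mem_preimage, e.right_inv hzt]
    have h1 : 0 < a z := by
      refine lt_of_le_of_ne hz.1 fun h0 => hne ?_
      have h2 : b z = 0 := by
        have h3 := hz.2.2
        rw [← h0, mul_zero] at h3
        exact abs_nonpos_iff.1 h3
      have h4 : z = e p := sub_eq_zero.1 (S.eq_of_coords (by rw [map_zero]; exact h0.symm)
        (by rw [map_zero]; exact h2))
      rw [h4]
      exact e.left_inv (mem_extChartAt_source p)
    exact ⟨hKb z hz, h1, hz.2.2.trans_lt (by nlinarith [mul_pos hε h1])⟩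
  have hVK : ∀ T, 0 ≤ T → (∀ t ∈ Icc 0 T, φ t (P u₀) ∈ V) → φ T (P u₀) ∈ K := by
    intro T hT hTV
    have hTT := hTV T ⟨hT, le_rfl⟩
    refine ⟨e (φ T (P u₀)), ⟨hTT.2.2.1.le, ?_, ?_⟩, e.left_inv hTT.1⟩
    · have hmono : AntitoneOn (fun t => a (e (φ t (P u₀)))) (Icc 0 T) := by
        refine antitoneOn_of_deriv_nonpos (convex_Icc 0 T)
          (fun t ht => (hda _ t (hTV t ht)).continuousAt.continuousWithinAt)
          (fun t ht => (hda _ t (hTV t (interior_subset ht))).differentiableAt.differentiableWithinAt)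
          ?_
        intro t ht
        rw [(hda _ t (hTV t (interior_subset ht))).deriv]
        exact (hVd _ (hTV t (interior_subset ht))).le
      have h1 := hmono (left_mem_Icc.2 hT) (right_mem_Icc.2 hT) hT
      simp only [hφ.zero] at h1
      rwa [hPe u₀ hu₀, hPa] at h1
    · by_contra hcon
      obtain ⟨σ, hσ, hσb⟩ : ∃ σ : ℝ, |σ| = 1 ∧ |b (e (φ T (P u₀)))| = σ * b (e (φ T (P u₀))) := by
        rcases abs_choice (b (e (φ T (P u₀)))) with h | h
        · exact ⟨1, by simp, by rw [h, one_mul]⟩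
        · exact ⟨-1, by simp, by rw [h]; ring⟩
      rw [hσb, not_le] at hcon
      exact hnot σ hσ ⟨T, hT, hTV, hTT.1, hcon⟩
  -- At a first exit time from `V` the point lies in the closed cone `K`, since all earlier ones do.
  -- But `K` without its tip is inside `V`, and the tip is not reached in finite time.
  have hforever : ∀ t, 0 ≤ t → φ t (P u₀) ∈ V := by
    by_contra! hcon
    set N : Set ℝ := Ici 0 ∩ (fun t => φ t (P u₀)) ⁻¹' Vᶜ with hN
    have hNc : IsClosed N :=
      isClosed_Ici.inter (hVo.isClosed_compl.preimage (hφ.continuous_time _))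
    have hNb : BddBelow N := ⟨0, fun t ht => ht.1⟩
    have hτ := hNc.csInf_mem (by obtain ⟨t, ht, h⟩ := hcon; exact ⟨t, ht, h⟩) hNb
    set τ := sInf N
    have hbefore : ∀ t, 0 ≤ t → t < τ → φ t (P u₀) ∈ V := fun t ht hlt => by
      by_contra h
      exact (csInf_le hNb ⟨ht, h⟩).not_gt hlt
    have hτ0 : 0 < τ := by
      refine lt_of_le_of_ne hτ.1 fun h0 => hτ.2 ?_
      rw [← h0]
      simp only [hφ.zero]
      exact hPV u₀ hu₀
    have hτK : φ τ (P u₀) ∈ K := by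
      have h1 : τ ∈ closure (Ico 0 τ) := by
        rw [closure_Ico hτ0.ne]
        exact right_mem_Icc.2 hτ0.le
      exact hKc.closure_subset (((hφ.continuous_time (P u₀)).continuousWithinAt).mem_closure h1
        fun t ht => hVK t ht.1 fun s hs => hbefore s hs.1 (hs.2.trans_lt ht.2))
    refine hτ.2 (hKV _ hτK fun heq => ?_)
    refine hVc _ (hPV u₀ hu₀) (hφ.isCriticalPoint_of_apply (t := τ) ?_)
    have heq' : φ τ (P u₀) = p := heq
    rwa [heq']
  refine hφ.mem_stable_of_forall_mem hf hKc (fun z hz hc => ?_)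
    fun t ht => hVK t ht fun s hs => hforever s hs.1
  by_contra hne
  exact hVc z (hKV z hz hne) hc

end IsGradFlow

/-- Choosing `|u|` minimal up to an error `t ^ 2` yields one selection that serves every `ε` at
once; no closedness of the relation is needed, and `t ^ 2` is `o(t)`. At `t = 0` the witness is `0`
itself. -/
theorem exists_isLittleO_selection {W : ℝ → ℝ → Prop} (h0 : W 0 0)
    (h : ∀ ε > 0, ∀ᶠ t in 𝓝[≠] (0 : ℝ), ∃ u, |u| ≤ ε * |t| ∧ W t u) :
    ∃ U : ℝ → ℝ, U 0 = 0 ∧ (U =o[𝓝 0] fun t => t) ∧ ∀ᶠ t in 𝓝 0, W t (U t) := by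
  have hex : ∀ t, ∃ u, (∃ v, W t v) → W t u ∧ ∀ v, W t v → |u| ≤ |v| + t ^ 2 := by
    intro t
    by_cases hv : ∃ v, W t v
    · rcases eq_or_ne t 0 with rfl | ht
      · exact ⟨0, fun _ => ⟨h0, fun v _ => by simp⟩⟩
      · have hne : ((fun v => |v|) '' {v | W t v}).Nonempty := by
          obtain ⟨v, hv⟩ := hv
          exact ⟨_, v, hv, rfl⟩
        obtain ⟨_, ⟨u, hu, rfl⟩, hlt⟩ := exists_lt_of_csInf_lt hne
          (lt_add_of_pos_right _ (by positivity : 0 < t ^ 2))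
        refine ⟨u, fun _ => ⟨hu, fun v hv => hlt.le.trans ?_⟩⟩
        gcongr
        refine csInf_le ⟨0, ?_⟩ ⟨v, hv, rfl⟩
        rintro _ ⟨w, -, rfl⟩
        exact abs_nonneg w
    · exact ⟨0, fun h => absurd h hv⟩
  choose U hU using hex
  have hU0 : U 0 = 0 := by
    have := (hU 0 ⟨0, h0⟩).2 0 h0
    simpa using this
  refine ⟨U, hU0, ?_, ?_⟩
  · rw [Asymptotics.isLittleO_iff]
    intro c hc
    filter_upwards [eventually_nhdsWithin_iff.1 (h (c / 2) (by positivity)),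
      Metric.ball_mem_nhds (0 : ℝ) (by positivity : 0 < c / 2)] with t h1 h2
    rcases eq_or_ne t 0 with rfl | ht
    · simp [hU0]
    obtain ⟨v, hv, hW⟩ := h1 ht
    have h3 := (hU t ⟨v, hW⟩).2 v hW
    rw [mem_ball_zero_iff, Real.norm_eq_abs] at h2
    rw [Real.norm_eq_abs, Real.norm_eq_abs]
    rw [← sq_abs t] at h3
    nlinarith [abs_nonneg t]
  · filter_upwards [eventually_nhdsWithin_iff.1 (h 1 one_pos)] with t h1
    rcases eq_or_ne t 0 with rfl | ht
    · rwa [hU0]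
    · obtain ⟨v, -, hW⟩ := h1 ht
      exact (hU t ⟨v, hW⟩).1

section

variable {n : ℕ} {M : Type*} [TopologicalSpace M] [ChartedSpace (EuclideanSpace ℝ (Fin n)) M]

theorem mem_tangentOf_of_hasDerivAt {S : Set M} {x : M} {c : ℝ → EuclideanSpace ℝ (Fin n)}
    {v : EuclideanSpace ℝ (Fin n)} (hc0 : c 0 = extChartAt (𝓡 n) x x) (hc : HasDerivAt c v 0)
    (hS : ∀ᶠ t in 𝓝 0, (extChartAt (𝓡 n) x).symm (c t) ∈ S) : v ∈ tangentOf (n := n) S x := by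
  set e := extChartAt (𝓡 n) x with he
  have hγ0 : (e.symm ∘ c) 0 = x := by
    rw [Function.comp_apply, hc0]
    exact e.left_inv (mem_extChartAt_source x)
  have ht : ∀ᶠ t in 𝓝 0, c t ∈ e.target := by
    refine hc.continuousAt.eventually_mem ?_
    rw [hc0]
    exact extChartAt_target_mem_nhds (I := 𝓡 n) x
  refine Submodule.subset_span ⟨e.symm ∘ c, hγ0, hS, hasMFDerivAt_curve_iff.2 ⟨?_, ?_⟩⟩
  · refine ContinuousAt.comp ?_ hc.continuousAt
    rw [hc0]
    exact continuousAt_extChartAt_symm (I := 𝓡 n) x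
  · rw [hγ0]
    refine hc.congr_of_eventuallyEq ?_
    filter_upwards [ht] with t h
    exact e.right_inv h

theorem tangentOf_eq_top_of_mem_nhds {S : Set M} {x : M} (hS : S ∈ 𝓝 x) :
    tangentOf (n := n) S x = ⊤ := by
  refine eq_top_iff.2 fun v _ => ?_
  let w : EuclideanSpace ℝ (Fin n) := v
  have hd : HasDerivAt (fun t : ℝ => extChartAt (𝓡 n) x x + t • w) w 0 := by
    simpa using ((hasDerivAt_id (0 : ℝ)).smul_const w).const_add (extChartAt (𝓡 n) x x)
  refine mem_tangentOf_of_hasDerivAt (c := fun t : ℝ => extChartAt (𝓡 n) x x + t • w) (by simp) hd ?_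
  have hc : ContinuousAt (fun t : ℝ => (extChartAt (𝓡 n) x).symm (extChartAt (𝓡 n) x x + t • w))
      0 := by
    refine ContinuousAt.comp (g := (extChartAt (𝓡 n) x).symm) ?_ hd.continuousAt
    rw [zero_smul, add_zero]
    exact continuousAt_extChartAt_symm (I := 𝓡 n) x
  refine hc.eventually_mem ?_
  rw [zero_smul, add_zero, (extChartAt (𝓡 n) x).left_inv (mem_extChartAt_source x)]
  exact hS

end

/-- The contracting direction of a saddle point is tangent to its stable manifold. -/
theorem IsGradFlow.es_mem_tangentOf_stable {n : ℕ} {M : Type*} [TopologicalSpace M]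
    [ChartedSpace (EuclideanSpace ℝ (Fin n)) M] [IsManifold (𝓡 n) ∞ M] [T2Space M]
    [CompactSpace M] {g : Metric n M} {f : M → ℝ} {φ : ℝ → M → M} (hφ : IsGradFlow g f φ)
    (hf : ContMDiff (𝓡 n) 𝓘(ℝ, ℝ) ∞ f) {p : M}
    (hp : IsCriticalPoint (n := n) f p) (S : SaddleFrame (linearization g f p)) :
    S.es ∈ tangentOf (n := n) (stable g f p) p := by
  set e := extChartAt (𝓡 n) p with he
  obtain ⟨U, hU0, hUo, hUW⟩ := exists_isLittleO_selection
    (W := fun t u => e.symm (e p + t • S.es + u • S.eu) ∈ stable g f p) (by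
      simp only [zero_smul, add_zero]
      rw [e.left_inv (mem_extChartAt_source p), hφ.mem_stable_iff]
      simp only [hφ.apply_of_isCriticalPoint hp]
      exact tendsto_const_nhds) (by
    intro ε hε
    -- The cone lemma loses a factor `2` and needs slope at most `1`. Negative `t` is covered by the
    -- flipped frame.
    have h1 : 0 < min 1 (ε / 2) := lt_min one_pos (by positivity)
    have h2 : 2 * min 1 (ε / 2) ≤ ε := by linarith [min_le_right 1 (ε / 2)]
    obtain ⟨ρ₁, hρ₁, H₁⟩ := hφ.exists_mem_stable_cone hf hp S h1 (min_le_left _ _)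
    obtain ⟨ρ₂, hρ₂, H₂⟩ := hφ.exists_mem_stable_cone hf hp S.flip h1 (min_le_left _ _)
    rw [eventually_nhdsWithin_iff]
    filter_upwards [Metric.ball_mem_nhds (0 : ℝ) (lt_min hρ₁ hρ₂)] with t ht ht0
    rw [mem_ball_zero_iff, Real.norm_eq_abs, lt_min_iff] at ht
    rcases lt_or_gt_of_ne ht0 with hneg | hpos
    · rw [abs_of_neg hneg] at ht ⊢
      obtain ⟨u, hu, hW⟩ := H₂ (-t) (by linarith) ht.2
      refine ⟨u, hu.trans (by gcongr; linarith), ?_⟩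
      have h3 : (-t) • S.flip.es = t • S.es := by
        change (-t) • (-S.es) = _
        simp
      rw [h3] at hW
      exact hW
    · rw [abs_of_pos hpos] at ht ⊢
      obtain ⟨u, hu, hW⟩ := H₁ t hpos ht.1
      exact ⟨u, hu.trans (by gcongr), hW⟩)
  -- `U` may be discontinuous away from `0`; `tangentOf` only asks for differentiability at time
  -- `0`.
  refine mem_tangentOf_of_hasDerivAt (c := fun t => e p + t • S.es + U t • S.eu)
    (by simp only [zero_smul, hU0, add_zero, he]) ?_ hUW
  have h1 : HasDerivAt U 0 0 := by
    rw [hasDerivAt_iff_isLittleO]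
    simpa [hU0] using hUo
  have h2 := ((hasDerivAt_id (0 : ℝ)).smul_const S.es).const_add (e p)
  simpa using! h2.add (h1.smul_const S.eu)

end StableTangent

/-! ### Passing to `-f` exchanges stable and unstable manifolds. -/

section TimeReversal

variable {n : ℕ} {M : Type*} [TopologicalSpace M] [ChartedSpace (EuclideanSpace ℝ (Fin n)) M]
  [IsManifold (𝓡 n) ∞ M] (g : Metric n M)

theorem IsFlowLine.neg {g : Metric n M} {f : M → ℝ} {γ : ℝ → M} (h : IsFlowLine g f γ) :
    IsFlowLine g (fun y => -f y) (fun t => γ (-t)) := by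
  have h1 := IsMIntegralCurve.comp_mul h (-1)
  have h2 : ((-1 : ℝ) • fun x => -grad g f x) = fun x => -grad g (fun y => -f y) x := by
    funext x
    rw [grad_neg, Pi.smul_apply, neg_one_smul]
  rw [h2] at h1
  have h3 : (γ ∘ fun t => t * (-1)) = fun t => γ (-t) := by
    funext t
    simp
  rw [h3] at h1
  exact h1

/-- The unstable manifolds of `f` are the stable manifolds of `-f`. -/
theorem unstable_eq_stable_neg (f : M → ℝ) (p : M) :
    unstable g f p = stable g (fun y => -f y) p := by
  ext y
  constructor
  · rintro ⟨γ, h1, h2, h3⟩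
    exact ⟨_, h1.neg, by simpa using h2, h3.comp tendsto_neg_atTop_atBot⟩
  · rintro ⟨γ, h1, h2, h3⟩
    have h4 := h1.neg
    simp only [neg_neg] at h4
    exact ⟨_, h4, by simpa using h2, h3.comp tendsto_neg_atBot_atTop⟩

theorem linearization_neg (f : M → ℝ) (p : M) :
    linearization g (fun y => -f y) p = -linearization g f p := by
  have h : chartField g (fun y => -f y) p = fun z => -chartField g f p z := by
    funext z
    have h1 : -grad g (fun y => -f y) ((extChartAt (𝓡 n) p).symm z) =
        -(-grad g f ((extChartAt (𝓡 n) p).symm z)) := congrArg _ (grad_neg g f _)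
    exact (congrArg (tangentCoordChange (𝓡 n) _ p _) h1).trans (map_neg _ _)
  unfold linearization
  rw [h, fderiv_fun_neg]

end TimeReversal

theorem isLocalMin_or_isLocalMax_or_isSaddle {n : ℕ} {M : Type*} [TopologicalSpace M]
    [ChartedSpace (EuclideanSpace ℝ (Fin n)) M] {f : M → ℝ} {p : M} (hp : IsCriticalPoint (n := n) f p) :
    IsLocalMin f p ∨ IsLocalMax f p ∨ IsSaddle n f p := by
  by_cases h : IsLocalExtr f p
  · exact h.imp id Or.inl
  · exact Or.inr (Or.inr ⟨hp, h⟩)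

/-! ### Tangent spaces by type of critical point, and the equivalence. -/

section SurfaceFlow

variable {M : Type*} [TopologicalSpace M] [T2Space M] [CompactSpace M]
  [ChartedSpace (EuclideanSpace ℝ (Fin 2)) M] [IsManifold (𝓡 2) ∞ M]
  {g : Metric 2 M} {f : M → ℝ}

theorem IsSaddle.tangentOf_stable_le (hf : IsMorse 2 f) {p x : M} (hp : IsSaddle 2 f p)
    (hx : x ∈ stable g f p) (hxc : ¬ IsCriticalPoint (n := 2) f x) :
    tangentOf (stable g f p) x ≤ Submodule.span ℝ {grad g f x} := by
  obtain ⟨φ, hφ⟩ := exists_isGradFlow g hf.smooth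
  obtain ⟨S⟩ := hp.nonempty_saddleFrame g hf
  exact hφ.tangentOf_stable_le hf hp.1 S hx hxc

theorem IsSaddle.tangentOf_unstable_le (hf : IsMorse 2 f) {p x : M} (hp : IsSaddle 2 f p)
    (hx : x ∈ unstable g f p) (hxc : ¬ IsCriticalPoint (n := 2) f x) :
    tangentOf (unstable g f p) x ≤ Submodule.span ℝ {grad g f x} := by
  rw [unstable_eq_stable_neg] at hx ⊢
  refine (hp.neg.tangentOf_stable_le hf.neg hx fun h => hxc (isCriticalPoint_neg.1 h)).trans ?_
  rw [Submodule.span_singleton_le_iff_mem, grad_neg]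
  exact Submodule.neg_mem _ (Submodule.mem_span_singleton_self _)

theorem tangentOf_stable_eq_top (hf : IsMorse 2 f) {q x : M} (hq : IsLocalMin f q)
    (hx : x ∈ stable g f q) : tangentOf (n := 2) (stable g f q) x = ⊤ := by
  obtain ⟨φ, hφ⟩ := exists_isGradFlow g hf.smooth
  exact tangentOf_eq_top_of_mem_nhds (hφ.stable_mem_nhds hf hq hx)

theorem tangentOf_unstable_eq_top (hf : IsMorse 2 f) {p x : M} (hp : IsLocalMax f p)
    (hx : x ∈ unstable g f p) : tangentOf (n := 2) (unstable g f p) x = ⊤ := by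
  rw [unstable_eq_stable_neg] at hx ⊢
  exact tangentOf_stable_eq_top hf.neg hp.neg hx

theorem IsSaddle.tangentOf_sup_eq_top (hf : IsMorse 2 f) {p : M} (hp : IsSaddle 2 f p) :
    tangentOf (n := 2) (stable g f p) p ⊔ tangentOf (n := 2) (unstable g f p) p = ⊤ := by
  obtain ⟨φ, hφ⟩ := exists_isGradFlow g hf.smooth
  obtain ⟨ψ, hψ⟩ := exists_isGradFlow g hf.neg.smooth
  obtain ⟨S⟩ := hp.nonempty_saddleFrame g hf
  have hs := hφ.es_mem_tangentOf_stable hf.smooth hp.1 S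
  have hu : S.eu ∈ tangentOf (n := 2) (unstable g f p) p := by
    rw [unstable_eq_stable_neg]
    -- The time-reversed frame, whose contracting vector is `S.eu`, transported along the equality
    -- of linearizations.
    have S' : {S' : SaddleFrame (linearization g (fun y => -f y) p) // S'.es = S.eu} := by
      rw [linearization_neg]
      exact ⟨S.neg, rfl⟩
    rw [← S'.2]
    exact hψ.es_mem_tangentOf_stable hf.neg.smooth hp.neg.1 S'.1
  refine eq_top_iff.2 fun v _ => ?_
  have h := S.decomp v
  rw [← h]
  exact Submodule.add_mem _ (Submodule.mem_sup_left (Submodule.smul_mem _ _ hs))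
    (Submodule.mem_sup_right (Submodule.smul_mem _ _ hu))

/-- Along a regular orbit tending to `q`, `f` stays strictly above `f q` arbitrarily close to `q`.
-/
theorem not_isLocalMax_of_mem_stable (hf : IsMorse 2 f) {q x : M} (hx : x ∈ stable g f q)
    (hxc : ¬ IsCriticalPoint (n := 2) f x) : ¬ IsLocalMax f q := by
  intro hq
  obtain ⟨φ, hφ⟩ := exists_isGradFlow g hf.smooth
  obtain ⟨t, ht⟩ := ((hφ.mem_stable_iff.1 hx).eventually hq).exists
  exact (hφ.lt_of_mem_stable hf.smooth ((hφ.apply_mem_stable_iff t).2 hx)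
    fun h => hxc (hφ.isCriticalPoint_of_apply h)).not_ge ht

theorem not_isLocalMin_of_mem_unstable (hf : IsMorse 2 f) {p x : M} (hx : x ∈ unstable g f p)
    (hxc : ¬ IsCriticalPoint (n := 2) f x) : ¬ IsLocalMin f p := by
  rw [unstable_eq_stable_neg] at hx
  exact fun h => not_isLocalMax_of_mem_stable hf.neg hx
    (fun h' => hxc (isCriticalPoint_neg.1 h')) h.neg

theorem isMorseSmale_of_forall_not_connects (hf : IsMorse 2 f)
    (h : ¬ ∃ (γ : ℝ → M) (p q : M), IsNeumannLine g f γ ∧ IsSaddle 2 f p ∧ IsSaddle 2 f q ∧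
      p ≠ q ∧ Connects γ q p) : IsMorseSmale g f := by
  refine ⟨hf, ?_⟩
  rintro p q hp hq x ⟨hxs, hxu⟩
  obtain ⟨φ, hφ⟩ := exists_isGradFlow g hf.smooth
  by_cases hxc : IsCriticalPoint (n := 2) f x
  · obtain rfl := hφ.eq_of_mem_stable hxs hxc
    obtain rfl := hφ.eq_of_mem_unstable hxu hxc
    rcases isLocalMin_or_isLocalMax_or_isSaddle hxc with h1 | h1 | h1
    · rw [tangentOf_stable_eq_top hf h1 hxs, top_sup_eq]
    · rw [tangentOf_unstable_eq_top hf h1 hxu, sup_top_eq]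
    · exact h1.tangentOf_sup_eq_top hf
  · rcases isLocalMin_or_isLocalMax_or_isSaddle hq with h1 | h1 | h1
    · rw [tangentOf_stable_eq_top hf h1 hxs, top_sup_eq]
    · exact absurd h1 (not_isLocalMax_of_mem_stable hf hxs hxc)
    · rcases isLocalMin_or_isLocalMax_or_isSaddle hp with h2 | h2 | h2
      · exact absurd h2 (not_isLocalMin_of_mem_unstable hf hxu hxc)
      · rw [tangentOf_unstable_eq_top hf h2 hxu, sup_top_eq]
      · refine absurd ⟨fun t => φ t x, q, p, ⟨hφ.line x, q, h1, Or.inl fun t => ⟨?_, ?_⟩⟩, h1, h2,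
          ?_, hφ.mem_unstable_iff.1 hxu, hφ.mem_stable_iff.1 hxs⟩ h
        · exact (hφ.apply_mem_stable_iff t).2 hxs
        · intro heq
          have heq' : φ t x = q := heq
          exact hxc (hφ.isCriticalPoint_of_apply (t := t) (by rwa [heq']))
        · rintro rfl
          exact lt_asymm (hφ.lt_of_mem_stable hf.smooth hxs hxc)
            (hφ.lt_of_mem_unstable hf.smooth hxu hxc)

theorem IsMorseSmale.not_exists_connects (h : IsMorseSmale g f) :
    ¬ ∃ (γ : ℝ → M) (p q : M), IsNeumannLine g f γ ∧ IsSaddle 2 f p ∧ IsSaddle 2 f q ∧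
      p ≠ q ∧ Connects γ q p := by
  rintro ⟨γ, p, q, ⟨hγ, -⟩, hp, hq, hne, hbot, htop⟩
  obtain ⟨hf, htrans⟩ := h
  obtain ⟨φ, hφ⟩ := exists_isGradFlow g hf.smooth
  have hxs : γ 0 ∈ stable g f p := ⟨γ, hγ, rfl, htop⟩
  have hxu : γ 0 ∈ unstable g f q := ⟨γ, hγ, rfl, hbot⟩
  have hxc : ¬ IsCriticalPoint (n := 2) f (γ 0) := fun hc =>
    hne ((hφ.eq_of_mem_stable hxs hc).symm.trans (hφ.eq_of_mem_unstable hxu hc))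
  have h1 : (⊤ : Submodule ℝ (TangentSpace (𝓡 2) (γ 0))) ≤
      Submodule.span ℝ {grad g f (γ 0)} := by
    rw [← htrans q p hq.1 hp.1 (γ 0) ⟨hxs, hxu⟩]
    exact sup_le (hp.tangentOf_stable_le hf hxs hxc) (hq.tangentOf_unstable_le hf hxu hxc)
  -- The whole tangent plane would lie in the line of the gradient, giving `2 ≤ 1`.
  have h2 := (Submodule.finrank_mono h1).trans (finrank_span_singleton
    fun h0 => hxc ((grad_eq_zero_iff g f (γ 0)).1 h0)).le
  rw [finrank_top] at h2
  have h3 : Module.finrank ℝ (TangentSpace (𝓡 2) (γ 0)) = 2 :=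
    finrank_euclideanSpace_fin (𝕜 := ℝ) (n := 2)
  omega

end SurfaceFlow

end GradientFlow

end

theorem mainTheorem8 {M : Type*} [TopologicalSpace M] [T2Space M] [CompactSpace M]
    [ChartedSpace (EuclideanSpace ℝ (Fin 2)) M] [IsManifold (𝓡 2) ∞ M]
    (g : GradientFlow.Metric 2 M) (f : M → ℝ) (hf : GradientFlow.IsMorse 2 f) :
    GradientFlow.IsMorseSmale g f ↔
      ¬ ∃ (γ : ℝ → M) (p q : M), GradientFlow.IsNeumannLine g f γ ∧
        GradientFlow.IsSaddle 2 f p ∧ GradientFlow.IsSaddle 2 f q ∧ p ≠ q ∧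
        GradientFlow.Connects γ q p :=
  ⟨fun h => h.not_exists_connects, GradientFlow.isMorseSmale_of_forall_not_connects hf⟩
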